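/- Let $\mathcal A=\mathbb Z[v,v^{-1}]$. A \emph{based ring} is a unital ring $R$ with a distinguished free $\mathbb Z$-basis having nonnegative structure constants; isomorphisms of based rings are ring isomorphisms matching the bases. A \emph{normalized table algebra} $(\Gamma,B)$ is a based ring with $1\in B$, an involutory anti-automorphism $\bar{\ }$ preserving $B$, and $\kappa(b_m,b_ib_j)=\kappa(b_i,b_m\overline{b_j})$ for all $b_i,b_j,b_m\in B$, where $\kappa(b,a)$ is the coefficient of $b$ in $a$. The based ring $M_{n,\Gamma,B}$ is the ring of $n\times n$ matrices over $\Gamma$ with basis $\{e_{ij}\otimes b : b\in B\}$. A \emph{based poset} is a poset $\Lambda$ with a based ring $f(\lambda)$ for each $\lambda\in\Lambda$; an isomorphism of based posets is an isomorphism of posets together with isomorphisms of the corresponding based rings. Let $A$ be an associative $\mathcal A$-algebra with an $\mathcal A$-basis $\mathbf B$, and let $\tau:A\to\mathcal A$ be $\mathcal A$-linear. Write $XY=\sum_Z g_{X,Y,Z}Z$ for $X,Y\in\mathbf B$; let $\mathbf a(Z)=\max_{X,Y}\deg g_{X,Y,Z}$ (assumed to exist), where $\deg$ is the highest power of $v$,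 and let $\gamma_{X,Y,Z}$ be the coefficient of $v^{\mathbf a(Z)}$ in $g_{X,Y,Z}$. A \emph{table datum} $(\Lambda,\Gamma,B,M,C,*)$ for $(A,\mathbf B,\tau)$ consists of a finite poset $\Lambda$, and for each $\lambda\in\Lambda$ a normalized table algebra $(\Gamma(\lambda),B(\lambda))$ and a nonempty finite set $M(\lambda)$, an injective map $C:\coprod_\lambda M(\lambda)\times B(\lambda)\times M(\lambda)\to A$, $(S,b,T)\mapsto C^b_{S,T}$, with image $\mathbf B$, and a map $*:A\to A$, such that: (A1) $\mathbf B$ contains a set of mutually orthogonal idempotents $\{1_\varepsilon\}$ with $A=\sum_{\varepsilon,\varepsilon'}1_\varepsilon A1_{\varepsilon'}$, and each $X\in\mathbf B$ satisfies $X=1_\varepsilon X1_{\varepsilon'}$ for some $\varepsilon,\varepsilon'$; (A2) $*$ is an $\mathcal A$-linear involutory anti-automorphism of $A$ with $(C^b_{S,T})^*=C^{\bar b}_{T,S}$; (A3) for all $\lambda\in\Lambda$ and $a\in A$ there are $r_a(S',S)\in\mathcal A\otimes_{\mathbb Z}\Gamma(\lambda)$ (for $S,S'\in M(\lambda)$)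 such that $a\,C^g_{S,T}\equiv\sum_{S'\in M(\lambda)}C^{r_a(S',S)g}_{S',T}$ for all $S,T\in M(\lambda)$ and $g\in\Gamma(\lambda)$, modulo the $\mathcal A$-span of the $C^{b}_{U,V}$ with $U,V\in M(\mu)$, $b\in B(\mu)$, $\mu<\lambda$ (where $C^g_{S,T}$ is extended linearly in $g$); (A4) for $K=C^b_{S,T}$, $K'=C^{b'}_{U,V}$, $K''=C^{b''}_{X,Y}$ one has $\deg g_{K,K',K''}=\mathbf a(K'')$ if and only if $X=S$, $T=U$, $Y=V$ (in the same $M(\lambda)$) and $\kappa(b'',bb')\neq0$; if moreover $b=b'=b''=1$, then $\gamma_{K,K',K''}=1$; (A5) $\tau(x)=\tau(x^*)$ and $\tau(xy)=\tau(yx)$ for all $x,y\in A$, and for $X=C^b_{S,T}$ the element $\tau(v^{\mathbf a(X)}X)$ is congruent modulo $v^{-1}\mathbb Z[v^{-1}]$ to $1$ if $S=T$ and $b=1$, and to $0$ otherwise. A table datum is \emph{reduced} if no strictly smaller partial order on $\Lambda$ satisfies (A1)--(A3) with the same remaining data. The objects of $\mathcal D(A,\mathbf B)$ are the tuples $(\Lambda,\Gamma,B,M,*)$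 for which there is a $C$ making $(\Lambda,\Gamma,B,M,C,*)$ a reduced table datum for $(A,\mathbf B,\tau)$. The morphisms $D\to D'$ are, for a fixed such $C$ for $D$, the maps $(C')^{-1}\circ C$ with $C'$ any such map for $D'$; composition is composition of maps. For $D=(\Lambda,\Gamma,B,M,*)$, let $P(D)$ be the based poset $\Lambda$ with $f(\lambda)=M_{|M(\lambda)|,\Gamma(\lambda),B(\lambda)}$. The category $\mathcal P(A,\mathbf B)$ has objects the $P(D)$ and morphisms the isomorphisms of based posets. \textbf{Theorem.} Suppose that $A$ is a reduced tabular algebra with trace $\tau$ and tabular basis $\mathbf B$, i.e. that $\mathcal D(A,\mathbf B)$ has an object. Then $\mathcal D(A,\mathbf B)$ is a well-defined category (the morphisms do not depend on the choice of $C$, and compositions of morphisms are morphisms), and it is equivalent to $\mathcal P(A,\mathbf B)$. More precisely, for every choice, for each object $D$, of bijections $s_\lambda:M(\lambda)\to\{1,\dots,|M(\lambda)|\}$, with $\pi_D(S,b,T)=e_{s_\lambda(S),s_\lambda(T)}\otimes b\in f(\lambda)$, there is a functor $P:\mathcal D(A,\mathbf B)\to\mathcal P(A,\mathbf B)$, given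 on objects by $D\mapsto P(D)$ and on morphisms $\theta:D_1\to D_2$ by $P(\theta)\circ\pi_{D_1}=\pi_{D_2}\circ\theta$, and it is an equivalence of categories. -/

import Mathlib

open CategoryTheory
open scoped TensorProduct

universe u w z

noncomputable section

namespace TabularAlg

/-- The ring `ℤ[v, v⁻¹]` of Laurent polynomials; the variable `v` is `LaurentPolynomial.T 1`. -/
abbrev LaurentRing : Type := LaurentPolynomial ℤ

/-! ### Based rings and normalized table algebras -/

/-- A based ring: a unital `ℤ`-algebra with a distinguished free `ℤ`-basis `B` (a subset) and
nonnegative structure constants.  The field `basis` is the Mathlib basis whose vectors are the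
elements of `B`; it is determined by `B`. -/
structure BasedRing where
  carrier : Type u
  [ring : Ring carrier]
  B : Set carrier
  basis : Module.Basis B ℤ carrier
  basis_apply : ∀ b : B, basis b = (b : carrier)
  nonneg : ∀ x y z : B, 0 ≤ basis.repr ((x : carrier) * (y : carrier)) z

attribute [instance] BasedRing.ring

/-- An isomorphism of based rings: a ring isomorphism that matches the distinguished bases
(an injective homomorphism sends no basis element to `0`). -/
@[ext]
structure BasedRingIso (X Y : BasedRing.{u}) where
  toRingEquiv : X.carrier ≃+* Y.carrier
  map_mem_iff : ∀ x : X.carrier, toRingEquiv x ∈ Y.B ↔ x ∈ X.B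

/-- The identity isomorphism of a based ring. -/
def BasedRingIso.refl (X : BasedRing.{u}) : BasedRingIso X X where
  toRingEquiv := RingEquiv.refl _
  map_mem_iff _ := Iff.rfl

/-- Composition of isomorphisms of based rings. -/
def BasedRingIso.trans {X Y Z : BasedRing.{u}} (f : BasedRingIso X Y) (g : BasedRingIso Y Z) :
    BasedRingIso X Z where
  toRingEquiv := f.toRingEquiv.trans g.toRingEquiv
  map_mem_iff x := (g.map_mem_iff _).trans (f.map_mem_iff x)

/-- A normalized table algebra over `ℤ`: a based ring `(Γ, B)` with `1 ∈ B`, with an involutory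
algebra anti-automorphism `bar` preserving `B`, and with
`κ(b_m, b_i b_j) = κ(b_i, b_m bar(b_j))`, where `κ(b, a)` is the coefficient of `b` in `a`.
(The map `bar` is determined by `(Γ, B)`, because `κ(1, b_i b_j) = κ(b_i, bar(b_j))`.) -/
structure NormalizedTableAlgebra extends BasedRing.{u} where
  one_mem : (1 : carrier) ∈ B
  bar : carrier →ₗ[ℤ] carrier
  bar_mul : ∀ x y, bar (x * y) = bar y * bar x
  bar_bar : ∀ x, bar (bar x) = x
  bar_mem : ∀ b ∈ B, bar b ∈ B
  kappa_mul : ∀ i j m : B,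
    basis.repr ((i : carrier) * (j : carrier)) m = basis.repr ((m : carrier) * bar j) i

/-- The identity element, as an element of the distinguished basis. -/
def NormalizedTableAlgebra.oneB (G : NormalizedTableAlgebra.{u}) : G.B := ⟨1, G.one_mem⟩

/-- The action of `bar` on the distinguished basis. -/
def NormalizedTableAlgebra.barB (G : NormalizedTableAlgebra.{u}) (b : G.B) : G.B :=
  ⟨G.bar b, G.bar_mem b b.2⟩

/-- The coefficient `κ(b, a)` of the basis element `b` in `a`. -/
def NormalizedTableAlgebra.kappa (G : NormalizedTableAlgebra.{u}) (b : G.B) (a : G.carrier) : ℤ :=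
  G.basis.repr a b

/-- The basis `e_{ij} ⊗ b` of the ring of `n × n` matrices over `Γ`, indexed by triples. -/
def matrixTripleBasis (n : ℕ) (G : NormalizedTableAlgebra.{u}) :
    Module.Basis (Fin n × Fin n × G.B) ℤ (Matrix (Fin n) (Fin n) G.carrier) :=
  G.basis.matrix (Fin n) (Fin n)

theorem matrixTripleBasis_apply (n : ℕ) (G : NormalizedTableAlgebra.{u}) (i j : Fin n) (b : G.B) :
    matrixTripleBasis n G (i, j, b) = Matrix.single i j (b : G.carrier) := by
  simp [matrixTripleBasis, G.basis_apply]

theorem matrixTripleBasis_repr (n : ℕ) (G : NormalizedTableAlgebra.{u})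
    (x : Matrix (Fin n) (Fin n) G.carrier) (i j : Fin n) (b : G.B) :
    (matrixTripleBasis n G).repr x (i, j, b) = G.basis.repr (x i j) b := by
  classical
  rw [← Module.Basis.coord_apply, ← Module.Basis.coord_apply]
  suffices h : (matrixTripleBasis n G).coord (i, j, b) =
      (G.basis.coord b) ∘ₗ (Matrix.entryLinearMap ℤ G.carrier i j) by
    rw [h]; rfl
  refine (matrixTripleBasis n G).ext ?_
  rintro ⟨k, l, c⟩
  rw [Module.Basis.coord_apply, Module.Basis.repr_self]
  simp only [Module.Basis.coord_apply, LinearMap.comp_apply,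
    Matrix.entryLinearMap_apply, matrixTripleBasis_apply, ← G.basis_apply]
  by_cases h : k = i ∧ l = j
  · obtain ⟨rfl, rfl⟩ := h
    simp [Finsupp.single_apply]
  · rw [Matrix.single_apply_of_ne _ _ _ _ _ h, Finsupp.single_apply, if_neg fun e => h (by simp_all)]
    simp

/-- The based ring `M_{n, Γ, B}`: the ring of `n × n` matrices over `Γ`, with distinguished basis
the matrices `e_{ij} ⊗ b`, that is, with the single nonzero entry `b ∈ B` in position `(i, j)`. -/
def matrixBasedRing (n : ℕ) (G : NormalizedTableAlgebra.{u}) : BasedRing.{u} where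
  carrier := Matrix (Fin n) (Fin n) G.carrier
  B := Set.range (matrixTripleBasis n G)
  basis := (matrixTripleBasis n G).reindexRange
  basis_apply b := Module.Basis.reindexRange_apply _ b
  nonneg := by
    rintro ⟨_, ⟨i, j, x⟩, rfl⟩ ⟨_, ⟨k, l, y⟩, rfl⟩ ⟨_, ⟨p, q, c⟩, rfl⟩
    rw [Module.Basis.reindexRange_repr]
    change 0 ≤ (matrixTripleBasis n G).repr
      (matrixTripleBasis n G (i, j, x) * matrixTripleBasis n G (k, l, y)) (p, q, c)
    rw [matrixTripleBasis_apply, matrixTripleBasis_apply]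
    by_cases hjk : j = k
    · subst hjk
      rw [Matrix.single_mul_single_same, matrixTripleBasis_repr]
      by_cases h : i = p ∧ l = q
      · obtain ⟨rfl, rfl⟩ := h
        rw [Matrix.single_apply_same]
        exact G.nonneg x y c
      · rw [Matrix.single_apply_of_ne _ _ _ _ _ h]
        simp
    · rw [Matrix.single_mul_single_of_ne _ _ _ _ hjk]
      simp

/-! ### Based posets -/

/-- A based poset: a poset together with a based ring for each of its elements. -/
structure BasedPoset where
  index : Type u
  [order : PartialOrder index]
  ring : index → BasedRing.{u}

attribute [instance] BasedPoset.order

/-- An isomorphism of based posets: an isomorphism of posets together with isomorphisms between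
the corresponding based rings. -/
@[ext]
structure BasedPosetIso (X Y : BasedPoset.{u}) where
  onIndex : X.index ≃o Y.index
  onRing : ∀ l : X.index, BasedRingIso (X.ring l) (Y.ring (onIndex l))

/-- The category of based posets; its morphisms are the isomorphisms of based posets. -/
instance : Category BasedPoset.{u} where
  Hom X Y := BasedPosetIso X Y
  id X := ⟨OrderIso.refl _, fun l => BasedRingIso.refl (X.ring l)⟩
  comp f g := ⟨f.onIndex.trans g.onIndex,
    fun l => (f.onRing l).trans (g.onRing (f.onIndex l))⟩

/-- The map on the disjoint union of the based rings induced by an isomorphism of based posets. -/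
def BasedPosetIso.total {X Y : BasedPoset.{u}} (f : BasedPosetIso X Y)
    (x : Σ l : X.index, (X.ring l).carrier) : Σ l : Y.index, (Y.ring l).carrier :=
  ⟨f.onIndex x.1, (f.onRing x.1).toRingEquiv x.2⟩

/-! ### The `a`-function of an algebra with a basis -/

section

variable {A : Type w} [NonUnitalRing A] [Module LaurentRing A] [IsScalarTower LaurentRing A A]
  [SMulCommClass LaurentRing A A] {ι : Type z}

/-- The structure constant `g_{X, Y, Z}`: the coefficient of `Z` in `X Y`. -/
def structConst (𝓑 : Module.Basis ι LaurentRing A) (X Y Z : ι) : LaurentRing :=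
  𝓑.repr (𝓑 X * 𝓑 Y) Z

/-- The degrees of the nonzero structure constants `g_{X, Y, Z}`, for fixed `Z`. -/
def degreeSet (𝓑 : Module.Basis ι LaurentRing A) (Z : ι) : Set ℤ :=
  {d | ∃ X Y : ι, (structConst 𝓑 X Y Z).degree = (d : WithBot ℤ)}

/-- The `a`-function: `a(Z)` is the maximum of the degrees of the `g_{X, Y, Z}`
(meaningful when this maximum exists). -/
def aFun (𝓑 : Module.Basis ι LaurentRing A) (Z : ι) : ℤ := sSup (degreeSet 𝓑 Z)

/-- `γ_{X, Y, Z}`: the coefficient of `v ^ a(Z)` in `g_{X, Y, Z}`. -/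
def gammaCoeff (𝓑 : Module.Basis ι LaurentRing A) (X Y Z : ι) : ℤ :=
  (structConst 𝓑 X Y Z).coeff (aFun 𝓑 Z)

/-- Membership in `v⁻¹ ℤ[v⁻¹]`. -/
def IsStrictlyNegative (p : LaurentRing) : Prop := ∀ n : ℤ, 0 ≤ n → p.coeff n = 0

/-! ### Table data -/

/-- The components `(Λ, Γ, B, M, *)` of a table datum, that is, all except the map `C`. -/
structure TableTuple (A : Type w) [NonUnitalRing A] [Module LaurentRing A] where
  index : Type u
  [order : PartialOrder index]
  [finite_index : Finite index]
  table : index → NormalizedTableAlgebra.{u}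
  M : index → Type u
  [fintype_M : ∀ l, Fintype (M l)]
  [nonempty_M : ∀ l, Nonempty (M l)]
  star : A →ₗ[LaurentRing] A

attribute [instance] TableTuple.order TableTuple.finite_index TableTuple.fintype_M
  TableTuple.nonempty_M

/-- The disjoint union of the sets `M(λ) × B(λ) × M(λ)`. -/
abbrev TableTuple.Triple (D : TableTuple.{u} A) : Type u :=
  Σ l : D.index, D.M l × (D.table l).B × D.M l

/-- The same tuple with another partial order on the index set. -/
def TableTuple.withOrder (D : TableTuple.{u} A) (o : PartialOrder D.index) : TableTuple.{u} A :=
  { D with order := o }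

/-- `C_{S, T}^g`, for `g ∈ ℤ[v, v⁻¹] ⊗ Γ(λ)`: the linear extension of `C_{S, T}^b = C(S, b, T)`. -/
def extendC (𝓑 : Module.Basis ι LaurentRing A) (D : TableTuple.{u} A) (C : D.Triple → ι)
    (l : D.index) (S T : D.M l) (g : LaurentRing ⊗[ℤ] (D.table l).carrier) : A :=
  ((Algebra.TensorProduct.basis LaurentRing (D.table l).basis).repr g).sum
    fun b c => c • 𝓑 (C ⟨l, S, b, T⟩)

/-- `A(< λ)`: the submodule generated by the `C(S, b, T)` with `S, T ∈ M(μ)`, `b ∈ B(μ)` and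
`μ < λ`. -/
def lowerSpan (𝓑 : Module.Basis ι LaurentRing A) (D : TableTuple.{u} A) (C : D.Triple → ι)
    (l : D.index) : Submodule LaurentRing A :=
  Submodule.span LaurentRing {x | ∃ t : D.Triple, t.1 < l ∧ x = 𝓑 (C t)}

/-- `(Λ, Γ, B, M, C, *)` is a table datum for `A` with tabular basis `𝓑`.  An injective map from
the triples to `A` with image the basis `𝓑` is recorded as a bijection `C` from the triples to the
index set of the basis; the corresponding element of `A` is `𝓑 (C t)`. -/
structure IsTableDatum (𝓑 : Module.Basis ι LaurentRing A) (D : TableTuple.{u} A)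
    (C : D.Triple → ι) : Prop where
  /-- `C` is injective with image the basis. -/
  bijective : Function.Bijective C
  /-- The basis contains a suitable set of mutually orthogonal idempotents. -/
  idempotents : ∃ E : Set ι,
    (∀ e ∈ E, 𝓑 e * 𝓑 e = 𝓑 e) ∧
    (∀ e ∈ E, ∀ f ∈ E, e ≠ f → 𝓑 e * 𝓑 f = 0) ∧
    AddSubgroup.closure {x : A | ∃ e ∈ E, ∃ f ∈ E, ∃ a : A, x = 𝓑 e * a * 𝓑 f} = ⊤ ∧
    ∀ X : ι, ∃ e ∈ E, ∃ f ∈ E, 𝓑 X = 𝓑 e * 𝓑 X * 𝓑 f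
  /-- `*` is an involutory linear anti-automorphism. -/
  star_star : ∀ x, D.star (D.star x) = x
  star_mul : ∀ x y, D.star (x * y) = D.star y * D.star x
  /-- `*` sends `C(S, b, T)` to `C(T, bar b, S)`. -/
  star_apply : ∀ (l : D.index) (S T : D.M l) (b : (D.table l).B),
    D.star (𝓑 (C ⟨l, S, b, T⟩)) = 𝓑 (C ⟨l, T, (D.table l).barB b, S⟩)
  /-- Left multiplication modulo `A(< λ)`. -/
  mul_mod_lower : ∀ (l : D.index) (a : A),
    ∃ r : D.M l → D.M l → LaurentRing ⊗[ℤ] (D.table l).carrier,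
      ∀ (S T : D.M l) (g : (D.table l).carrier),
        a * extendC 𝓑 D C l S T (1 ⊗ₜ[ℤ] g) -
          ∑ S' : D.M l, extendC 𝓑 D C l S' T (r S' S * (1 ⊗ₜ[ℤ] g)) ∈ lowerSpan 𝓑 D C l

/-- The two further axioms of a tabular algebra with trace, with respect to the given linear
function `τ`. -/
structure IsTraceDatum (𝓑 : Module.Basis ι LaurentRing A) (τ : A →ₗ[LaurentRing] LaurentRing)
    (D : TableTuple.{u} A) (C : D.Triple → ι) : Prop where
  /-- The maximum defining the `a`-function exists. -/
  a_isGreatest : ∀ Z : ι, IsGreatest (degreeSet 𝓑 Z) (aFun 𝓑 Z)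
  /-- The degree bound is achieved by `g_{K, K', K''}` exactly when `K = C(S, b, T)`,
  `K' = C(T, b', V)`, `K'' = C(S, b'', V)` for elements of the same `M(λ)`, `B(λ)` with
  `κ(b'', b b') ≠ 0`. -/
  bound_iff : ∀ k k' k'' : D.Triple,
    (structConst 𝓑 (C k) (C k') (C k'')).degree = (aFun 𝓑 (C k'') : WithBot ℤ) ↔
      ∃ (l : D.index) (S T V : D.M l) (b b' b'' : (D.table l).B),
        k = ⟨l, S, b, T⟩ ∧ k' = ⟨l, T, b', V⟩ ∧ k'' = ⟨l, S, b'', V⟩ ∧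
        (D.table l).kappa b'' ((b : (D.table l).carrier) * (b' : (D.table l).carrier)) ≠ 0
  /-- The leading coefficient is `1` when `b = b' = b'' = 1`. -/
  gamma_one : ∀ (l : D.index) (S T V : D.M l),
    gammaCoeff 𝓑 (C ⟨l, S, (D.table l).oneB, T⟩) (C ⟨l, T, (D.table l).oneB, V⟩)
      (C ⟨l, S, (D.table l).oneB, V⟩) = 1
  /-- `τ` is a `*`-invariant trace. -/
  trace_star : ∀ x, τ x = τ (D.star x)
  trace_comm : ∀ x y, τ (x * y) = τ (y * x)
  /-- `τ(v^{a(X)} X)` is congruent to `1` modulo `v⁻¹ ℤ[v⁻¹]` for `X = C(S, 1, S)` -/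
  trace_one : ∀ (l : D.index) (S : D.M l),
    IsStrictlyNegative
      (τ ((LaurentPolynomial.T (aFun 𝓑 (C ⟨l, S, (D.table l).oneB, S⟩)) : LaurentRing) •
        𝓑 (C ⟨l, S, (D.table l).oneB, S⟩)) - 1)
  /-- and to `0` for every other `X = C(S, b, T)`. -/
  trace_zero : ∀ (l : D.index) (S T : D.M l) (b : (D.table l).B),
    ¬ (S = T ∧ b = (D.table l).oneB) →
      IsStrictlyNegative
        (τ ((LaurentPolynomial.T (aFun 𝓑 (C ⟨l, S, b, T⟩)) : LaurentRing) •
          𝓑 (C ⟨l, S, b, T⟩)))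

/-- A table datum is reduced if the partial order on `Λ` cannot be replaced by a strictly smaller
one. -/
def IsReducedDatum (𝓑 : Module.Basis ι LaurentRing A) (D : TableTuple.{u} A)
    (C : D.Triple → ι) : Prop :=
  ∀ o : PartialOrder D.index, (∀ x y : D.index, o.le x y → D.order.le x y) →
    IsTableDatum 𝓑 (D.withOrder o) C → o = D.order

/-- `(Λ, Γ, B, M, C, *)` is a reduced table datum with tabular basis `𝓑` satisfying the axioms of
a tabular algebra with trace `τ`. -/
def IsReducedTraceDatum (𝓑 : Module.Basis ι LaurentRing A)
    (τ : A →ₗ[LaurentRing] LaurentRing) (D : TableTuple.{u} A) (C : D.Triple → ι) : Prop :=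
  IsTableDatum 𝓑 D C ∧ IsTraceDatum 𝓑 τ D C ∧ IsReducedDatum 𝓑 D C

/-! ### The two categories -/

/-- The objects of `𝓓(A, 𝓑) = 𝓓(A, 𝓑, τ)`: the tuples `(Λ, Γ, B, M, *)` for which a suitable map
`C` exists. -/
structure TableObj (𝓑 : Module.Basis ι LaurentRing A)
    (τ : A →ₗ[LaurentRing] LaurentRing) where
  tuple : TableTuple.{u} A
  exists_datum : ∃ C : tuple.Triple → ι, IsReducedTraceDatum 𝓑 τ tuple C

variable {𝓑 : Module.Basis ι LaurentRing A} {τ : A →ₗ[LaurentRing] LaurentRing}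

/-- `θ` has the form `(C')⁻¹ ∘ C`, for the given map `C` and some map `C'` such that
`(Λ', Γ', B', M', C', *')` is a reduced table datum. -/
def IsMorphismFrom (D D' : TableObj.{u} 𝓑 τ) (C : D.tuple.Triple → ι)
    (θ : D.tuple.Triple → D'.tuple.Triple) : Prop :=
  ∃ C' : D'.tuple.Triple → ι, IsReducedTraceDatum 𝓑 τ D'.tuple C' ∧ ∀ t, C' (θ t) = C t

/-- The morphisms of `𝓓(A, 𝓑)`: the maps that are of the form `(C')⁻¹ ∘ C` for every admissible
`C`.  With this form, closure under composition is evident; that one fixed admissible `C` gives the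
same maps is not, and is not assumed. -/
@[ext]
structure TableHom (D D' : TableObj.{u} 𝓑 τ) where
  map : D.tuple.Triple → D'.tuple.Triple
  isMorphism : ∀ C : D.tuple.Triple → ι, IsReducedTraceDatum 𝓑 τ D.tuple C →
    IsMorphismFrom D D' C map

/-- The category `𝓓(A, 𝓑)`; composition is composition of maps. -/
instance : Category (TableObj.{u} 𝓑 τ) where
  Hom D D' := TableHom D D'
  id D := ⟨id, fun C hC => ⟨C, hC, fun _ => rfl⟩⟩
  comp f g := ⟨g.map ∘ f.map, fun C hC => by
    obtain ⟨C', hC', h⟩ := f.isMorphism C hC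
    obtain ⟨C'', hC'', h'⟩ := g.isMorphism C' hC'
    exact ⟨C'', hC'', fun t => (h' _).trans (h t)⟩⟩

/-- The based poset `P(D)`: the poset `Λ` with the based rings `M_{|M(λ)|, Γ(λ), B(λ)}`. -/
def TableObj.basedPoset (D : TableObj.{u} 𝓑 τ) : BasedPoset.{u} where
  index := D.tuple.index
  ring l := matrixBasedRing (Fintype.card (D.tuple.M l)) (D.tuple.table l)

variable (𝓑 τ) in
/-- The category `𝓟(A, 𝓑)`: its objects are the based posets `P(D)`, and its morphisms are the
isomorphisms of based posets. -/
abbrev BasedPosetCat : Type (u + 1) :=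
  ObjectProperty.FullSubcategory fun X : BasedPoset.{u} =>
    ∃ D : TableObj.{u} 𝓑 τ, D.basedPoset = X

/-- `P(D)` as an object of `𝓟(A, 𝓑)`. -/
def TableObj.toBasedPosetCat (D : TableObj.{u} 𝓑 τ) : BasedPosetCat.{u} 𝓑 τ :=
  ⟨D.basedPoset, D, rfl⟩

/-- A choice of numberings `s_λ : M(λ) → {1, …, |M(λ)|}`, which gives a parametrization. -/
abbrev Parametrization (D : TableObj.{u} 𝓑 τ) : Type u :=
  ∀ l : D.tuple.index, D.tuple.M l ≃ Fin (Fintype.card (D.tuple.M l))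

/-- The map `π(S, b, T) = e_{s(S), s(T)} ⊗ b` of a parametrization. -/
def Parametrization.toMap {D : TableObj.{u} 𝓑 τ} (s : Parametrization D) (t : D.tuple.Triple) :
    Σ l : D.basedPoset.index, (D.basedPoset.ring l).carrier :=
  ⟨t.1, (Matrix.single (s t.1 t.2.1) (s t.1 t.2.2.2) (t.2.2.1 : (D.tuple.table t.1).carrier) :
    Matrix (Fin (Fintype.card (D.tuple.M t.1))) (Fin (Fintype.card (D.tuple.M t.1)))
      (D.tuple.table t.1).carrier)⟩

end

end TabularAlg

end

namespace TabularAlg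

/-! ### Coefficients in normalized table algebras -/

namespace NormalizedTableAlgebra

variable (G : NormalizedTableAlgebra.{u})

/-! The leading coefficients `γ` are the structure constants of an asymptotic ring, which is defined
by `𝓑` alone. The key fact, `IsTraceDatum.gammaCoeff_eq`, is that every table datum identifies these
constants with those (`mulCoeff`) of the product over `λ` of the matrix rings over `Γ(λ)`. Axiom
(A4) only says where the constants are nonzero. By (A3) the coefficients are `κ(b'', b b')` times a
factor depending on the left factor only; the involution moves this factor to that of some `(T, 1,
T)`, where (A4) makes it `1`.

Hence for two data the bijection `C'⁻¹ ∘ C` preserves `mulCoeff`; it is a `TripleIso`. The blocks,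
the triples `(S, 1, S)` and the map `(S, b, T) ↦ (T, b̄, S)` are all expressible by `mulCoeff`, so a
`TripleIso` splits into bijections of the `Λ`, of the `M(λ)`, and, for each pair `(S, T)`, of the
`B(λ)`. The last may vary with `(S, T)`, but together they are compatible with matrix
multiplication.

The partial orders do not enter `mulCoeff`. Here reducedness is used: (A3) remains true for the
intersection of one order with the pullback of the other, so the two orders correspond
(`onIndex_le_iff`). Conversely, an order-compatible `TripleIso` transports any reduced datum
(`IsReducedTraceDatum.transport`).

So the morphisms `D ⟶ D'` are exactly the order-compatible `TripleIso`s, whichever `C` is used.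
Isomorphisms `P(D) → P(D')` are the same thing, since the matrices `e_{ij} ⊗ b` form the bases and
multiply by `mulCoeff`. This makes `P` fully faithful; it is surjective on objects by definition. -/

theorem kappa_self (b : G.B) : G.kappa b (b : G.carrier) = 1 := by
  rw [kappa, ← G.basis_apply, Module.Basis.repr_self, Finsupp.single_eq_same]

theorem kappa_coe_ne_zero {b c : G.B} : G.kappa b (c : G.carrier) ≠ 0 ↔ b = c := by
  classical
  rw [kappa, ← G.basis_apply, Module.Basis.repr_self, Finsupp.single_apply]
  simp [eq_comm]

theorem kappa_eq_of_ne {b c : G.B} (h : b ≠ c) : G.kappa b (c : G.carrier) = 0 := by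
  by_contra h'
  exact h (G.kappa_coe_ne_zero.1 h')

theorem barB_barB (b : G.B) : G.barB (G.barB b) = b := Subtype.ext (G.bar_bar b)

theorem coe_barB (b : G.B) : ((G.barB b : G.B) : G.carrier) = G.bar b := rfl

theorem coe_oneB : ((G.oneB : G.B) : G.carrier) = 1 := rfl

theorem bar_one : G.bar 1 = 1 := by
  have h := G.bar_mul (G.bar 1) 1
  rw [mul_one, G.bar_bar, mul_one] at h
  exact h.symm

theorem barB_oneB : G.barB G.oneB = G.oneB := Subtype.ext G.bar_one

/-- `κ(1, b c̄) = κ(b, c)`. -/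
theorem kappa_oneB_mul_barB (b c : G.B) :
    G.kappa G.oneB ((b : G.carrier) * (G.barB c : G.carrier)) = G.kappa b (c : G.carrier) := by
  have h := G.kappa_mul b (G.barB c) G.oneB
  rwa [G.coe_oneB, one_mul, G.coe_barB, G.bar_bar, ← G.coe_barB] at h

/-- The case `b_m = 1` of the identity for `κ`; it makes `bar` visible in the multiplication. -/
theorem kappa_oneB_mul_ne_zero {b c : G.B} :
    G.kappa G.oneB ((b : G.carrier) * (c : G.carrier)) ≠ 0 ↔ c = G.barB b := by
  have h := G.kappa_oneB_mul_barB b (G.barB c)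
  rw [G.barB_barB] at h
  rw [h, kappa_coe_ne_zero]
  constructor
  · rintro rfl; rw [G.barB_barB]
  · rintro rfl; rw [G.barB_barB]

/-- The basis of `ℤ[v, v⁻¹] ⊗ Γ` formed by the elements of `B`. -/
noncomputable abbrev laurentBasis : Module.Basis G.B LaurentRing (LaurentRing ⊗[ℤ] G.carrier) :=
  Algebra.TensorProduct.basis LaurentRing G.basis

theorem laurentBasis_apply (b : G.B) : G.laurentBasis b = 1 ⊗ₜ[ℤ] (b : G.carrier) := by
  rw [Algebra.TensorProduct.basis_apply, G.basis_apply]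

theorem laurentBasis_repr_one_tmul (x : G.carrier) (b : G.B) :
    G.laurentBasis.repr (1 ⊗ₜ[ℤ] x) b = (G.kappa b x : LaurentRing) := by
  rw [Algebra.TensorProduct.basis_repr_tmul, one_smul, Finsupp.mapRange_apply]
  simp [kappa]

theorem laurentBasis_repr_mul (x : LaurentRing ⊗[ℤ] G.carrier) (b c : G.B) :
    G.laurentBasis.repr (x * (1 ⊗ₜ[ℤ] (b : G.carrier))) c =
      (G.laurentBasis.repr x).sum fun d r => G.kappa c ((d : G.carrier) * b) • r := by
  conv_lhs => rw [← G.laurentBasis.linearCombination_repr x]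
  rw [Finsupp.linearCombination_apply, Finsupp.sum, Finset.sum_mul, map_sum,
    Finsupp.finsetSum_apply, Finsupp.sum]
  refine Finset.sum_congr rfl fun d _ => ?_
  rw [laurentBasis_apply, smul_mul_assoc, Algebra.TensorProduct.tmul_mul_tmul, one_mul, map_smul,
    Finsupp.smul_apply, laurentBasis_repr_one_tmul, smul_eq_mul, zsmul_eq_mul, mul_comm]

end NormalizedTableAlgebra

/-! ### Structure constants of the asymptotic ring -/

section MulCoeff

variable {A : Type w} [NonUnitalRing A] [Module LaurentRing A]

namespace TableTuple

variable (D : TableTuple.{u} A)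

open Classical in
/-- The element `e_{ST} ⊗ b` of the product over `λ` of the matrix rings over `Γ(λ)`. -/
noncomputable def matrixUnit (t : D.Triple) :
    ∀ l, Matrix (D.M l) (D.M l) (D.table l).carrier :=
  Pi.single t.1 (Matrix.single t.2.1 t.2.2.2 (t.2.2.1 : (D.table t.1).carrier))

/-- The structure constants of the product of the matrix rings over the `Γ(λ)`. -/
noncomputable def mulCoeff (k k' k'' : D.Triple) : ℤ :=
  (D.table k''.1).kappa k''.2.2.1
    ((D.matrixUnit k * D.matrixUnit k') k''.1 k''.2.1 k''.2.2.2)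

/-- The anti-automorphism `(S, b, T) ↦ (T, b̄, S)` of the triples. -/
def starTriple (t : D.Triple) : D.Triple := ⟨t.1, t.2.2.2, (D.table t.1).barB t.2.2.1, t.2.1⟩

/-- The triples `(S, 1, S)`. -/
def IsUnitTriple (t : D.Triple) : Prop := t.2.1 = t.2.2.2 ∧ t.2.2.1 = (D.table t.1).oneB

/-- The triple `(S, 1, S)`. -/
def unitTriple (l : D.index) (S : D.M l) : D.Triple := ⟨l, S, (D.table l).oneB, S⟩

variable {D}

theorem isUnitTriple_unitTriple (l : D.index) (S : D.M l) : D.IsUnitTriple (D.unitTriple l S) :=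
  ⟨rfl, rfl⟩

open Classical in
theorem mulCoeff_mk (l : D.index) (S T U V X Y : D.M l) (b b' b'' : (D.table l).B) :
    D.mulCoeff ⟨l, S, b, T⟩ ⟨l, U, b', V⟩ ⟨l, X, b'', Y⟩ = (D.table l).kappa b''
      (if S = X ∧ V = Y ∧ T = U then (b : (D.table l).carrier) * b' else 0) := by
  rw [mulCoeff, matrixUnit, matrixUnit, Pi.mul_apply, Pi.single_eq_same, Pi.single_eq_same]
  congr 1
  by_cases h : T = U
  · subst h
    simp [Matrix.single_mul_single_same, Matrix.single_apply]
  · simp [Matrix.single_mul_single_of_ne _ _ _ _ h, h]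

theorem mulCoeff_same (l : D.index) (S T V : D.M l) (b b' b'' : (D.table l).B) :
    D.mulCoeff ⟨l, S, b, T⟩ ⟨l, T, b', V⟩ ⟨l, S, b'', V⟩ =
      (D.table l).kappa b'' ((b : (D.table l).carrier) * b') := by
  rw [mulCoeff_mk]; simp

/-- The right-hand side is the condition of (A4), so the degree bound is attained exactly where
`mulCoeff` does not vanish. -/
theorem mulCoeff_ne_zero_iff {k k' k'' : D.Triple} : D.mulCoeff k k' k'' ≠ 0 ↔
    ∃ (l : D.index) (S T V : D.M l) (b b' b'' : (D.table l).B),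
      k = ⟨l, S, b, T⟩ ∧ k' = ⟨l, T, b', V⟩ ∧ k'' = ⟨l, S, b'', V⟩ ∧
      (D.table l).kappa b'' ((b : (D.table l).carrier) * (b' : (D.table l).carrier)) ≠ 0 := by
  classical
  constructor
  · intro h
    obtain ⟨l, S, b, T⟩ := k
    obtain ⟨l', U, b', V⟩ := k'
    obtain ⟨l'', X, b'', Y⟩ := k''
    have h1 : l'' = l := by
      by_contra hl
      refine h ?_
      rw [mulCoeff, Pi.mul_apply, matrixUnit, Pi.single_eq_of_ne (by exact hl), zero_mul]
      simp [NormalizedTableAlgebra.kappa]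
    subst h1
    have h2 : l'' = l' := by
      by_contra hl
      refine h ?_
      have h0 : D.matrixUnit ⟨l', U, b', V⟩ l'' = 0 := by
        rw [matrixUnit, Pi.single_eq_of_ne (by exact hl)]
      rw [mulCoeff, Pi.mul_apply, h0, mul_zero]
      simp [NormalizedTableAlgebra.kappa]
    subst h2
    have h3 : S = X ∧ V = Y ∧ T = U := by
      by_contra hl
      refine h ?_
      rw [mulCoeff_mk, if_neg hl]
      simp [NormalizedTableAlgebra.kappa]
    obtain ⟨rfl, rfl, rfl⟩ := h3
    rw [mulCoeff_same] at h
    exact ⟨l'', S, T, V, b, b', b'', rfl, rfl, rfl, h⟩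
  · rintro ⟨l, S, T, V, b, b', b'', rfl, rfl, rfl, h⟩
    rwa [mulCoeff_same]

theorem starTriple_starTriple (t : D.Triple) : D.starTriple (D.starTriple t) = t := by
  obtain ⟨l, S, b, T⟩ := t
  simp [starTriple, NormalizedTableAlgebra.barB_barB]

theorem mulCoeff_unitTriple_left (l : D.index) (S T : D.M l) (b : (D.table l).B) :
    D.mulCoeff (D.unitTriple l S) ⟨l, S, b, T⟩ ⟨l, S, b, T⟩ = 1 := by
  rw [unitTriple, mulCoeff_same, NormalizedTableAlgebra.coe_oneB, one_mul,
    NormalizedTableAlgebra.kappa_self]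

theorem mulCoeff_unitTriple_right (l : D.index) (S T : D.M l) (b : (D.table l).B) :
    D.mulCoeff ⟨l, S, b, T⟩ (D.unitTriple l T) ⟨l, S, b, T⟩ = 1 := by
  rw [unitTriple, mulCoeff_same, NormalizedTableAlgebra.coe_oneB, mul_one,
    NormalizedTableAlgebra.kappa_self]

/-- The triples `(S, 1, S)` are characterized by the structure constants. -/
theorem isUnitTriple_iff (t : D.Triple) :
    D.IsUnitTriple t ↔ ∀ x z, D.mulCoeff t x z ≠ 0 → z = x := by
  constructor
  · obtain ⟨l, S, b, T⟩ := t
    rintro ⟨h, h'⟩ x z hx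
    obtain ⟨m, S', T', V, c, b', b'', h1, rfl, rfl, h4⟩ := mulCoeff_ne_zero_iff.1 hx
    cases h1
    change S = T at h
    change b = (D.table l).oneB at h'
    subst h h'
    rw [NormalizedTableAlgebra.coe_oneB, one_mul, NormalizedTableAlgebra.kappa_coe_ne_zero] at h4
    rw [h4]
  · obtain ⟨l, S, b, T⟩ := t
    intro h
    -- Test with `x = (T, 1, T)` and `z = t`: since `t` occurs in `t x`, the condition forces `t =
    -- x`.
    have h1 := h (D.unitTriple l T) ⟨l, S, b, T⟩ (by rw [mulCoeff_unitTriple_right]; simp)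
    rw [unitTriple] at h1
    cases h1
    exact ⟨rfl, rfl⟩

/-- In a product `x y`, a triple `(S, 1, S)` occurs only if the outer indices match and `1` occurs
in `b b'`, that is, `b' = b̄`. As the triples `(S, 1, S)` are themselves characterized by
`mulCoeff`, so is the involution. -/
theorem starTriple_eq_iff (x y : D.Triple) :
    y = D.starTriple x ↔ ∃ z, D.IsUnitTriple z ∧ D.mulCoeff x y z ≠ 0 := by
  constructor
  · rintro rfl
    obtain ⟨l, S, b, T⟩ := x
    refine ⟨D.unitTriple l S, isUnitTriple_unitTriple l S, ?_⟩
    rw [starTriple, unitTriple, mulCoeff_same, NormalizedTableAlgebra.kappa_oneB_mul_ne_zero]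
  · rintro ⟨z, ⟨hz, hz'⟩, h⟩
    obtain ⟨l, S, T, V, b, b', b'', rfl, rfl, rfl, h4⟩ := mulCoeff_ne_zero_iff.1 h
    change S = V at hz
    change b'' = (D.table l).oneB at hz'
    subst hz hz'
    rw [NormalizedTableAlgebra.kappa_oneB_mul_ne_zero] at h4
    rw [starTriple, h4]

/-- Two triples belong to the same block if and only if the product `x w y` is nonzero for some
`w`. -/
theorem fst_eq_iff (x y : D.Triple) :
    x.1 = y.1 ↔ ∃ p q r, D.mulCoeff x p q ≠ 0 ∧ D.mulCoeff q y r ≠ 0 := by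
  constructor
  · obtain ⟨l, S, b, T⟩ := x
    obtain ⟨l', U, c, V⟩ := y
    rintro h
    change l = l' at h
    subst h
    -- The connecting factor is `(T, b̄, U)`: its product with `x` contains `(S, 1, U)`, which can
    -- be multiplied by `y`.
    refine ⟨⟨l, T, (D.table l).barB b, U⟩, ⟨l, S, (D.table l).oneB, U⟩, ⟨l, S, c, V⟩, ?_, ?_⟩
    · rw [mulCoeff_same, NormalizedTableAlgebra.kappa_oneB_mul_ne_zero]
    · rw [mulCoeff_same, NormalizedTableAlgebra.coe_oneB, one_mul,
        NormalizedTableAlgebra.kappa_self]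
      simp
  · rintro ⟨p, q, r, h, h'⟩
    obtain ⟨l, S, T, V, b, b', b'', rfl, rfl, rfl, -⟩ := mulCoeff_ne_zero_iff.1 h
    obtain ⟨m, S', T', V', c, c', c'', h1, rfl, rfl, -⟩ := mulCoeff_ne_zero_iff.1 h'
    have h2 := congrArg (fun t : D.Triple => t.1) h1
    exact h2

end TableTuple

end MulCoeff

section Asymptotic

variable {A : Type w} [NonUnitalRing A] [Module LaurentRing A] {ι : Type z}

open TableTuple

/-! ### Coefficients modulo `A(< λ)` -/

theorem coeff_eq_zero_of_degree_lt {p : LaurentRing} {n : ℤ} (h : p.degree < (n : WithBot ℤ)) :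
    p.coeff n = 0 := by
  by_contra h'
  exact absurd (Finset.le_max (Finsupp.mem_support_iff.2 h')) (not_le_of_gt h)

theorem coeff_zsmul (n : ℤ) (p : LaurentRing) (d : ℤ) : (n • p).coeff d = n * p.coeff d := by
  rw [AddMonoidAlgebra.coeff_smul, Finsupp.smul_apply, smul_eq_mul]

section ExtendC

variable (𝓑 : Module.Basis ι LaurentRing A) (D : TableTuple.{u} A) {C : D.Triple → ι}

theorem repr_extendC (l : D.index) (S T : D.M l) (g : LaurentRing ⊗[ℤ] (D.table l).carrier) :
    𝓑.repr (extendC 𝓑 D C l S T g) =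
      ((D.table l).laurentBasis.repr g).mapDomain fun b => C ⟨l, S, b, T⟩ := by
  rw [extendC, map_finsuppSum, Finsupp.mapDomain]
  refine Finsupp.sum_congr fun b _ => ?_
  rw [map_smul, 𝓑.repr_self, Finsupp.smul_single, smul_eq_mul, mul_one]

theorem repr_extendC_self (hC : C.Injective) (l : D.index) (S T : D.M l)
    (g : LaurentRing ⊗[ℤ] (D.table l).carrier) (b : (D.table l).B) :
    𝓑.repr (extendC 𝓑 D C l S T g) (C ⟨l, S, b, T⟩) = (D.table l).laurentBasis.repr g b := by
  rw [repr_extendC]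
  refine Finsupp.mapDomain_apply (f := fun b => C ⟨l, S, b, T⟩) (fun b b' h => ?_) _ _
  have h' := hC h
  cases h'
  rfl

theorem repr_extendC_of_ne (hC : C.Injective) (l : D.index) (S T : D.M l)
    (g : LaurentRing ⊗[ℤ] (D.table l).carrier) (t : D.Triple)
    (ht : ∀ b, t ≠ ⟨l, S, b, T⟩) : 𝓑.repr (extendC 𝓑 D C l S T g) (C t) = 0 := by
  rw [repr_extendC]
  refine Finsupp.mapDomain_of_notMem_range _ _ ?_
  rintro ⟨b, hb⟩
  exact ht b (hC hb).symm

theorem extendC_one_tmul (l : D.index) (S T : D.M l) (b : (D.table l).B) :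
    extendC 𝓑 D C l S T (1 ⊗ₜ[ℤ] (b : (D.table l).carrier)) = 𝓑 (C ⟨l, S, b, T⟩) := by
  rw [extendC, ← NormalizedTableAlgebra.laurentBasis_apply, Module.Basis.repr_self,
    Finsupp.sum_single_index (by rw [zero_smul]), one_smul]

theorem lowerSpan_eq (l : D.index) :
    lowerSpan 𝓑 D C l = Submodule.span LaurentRing (𝓑 '' (C '' {t | t.1 < l})) := by
  rw [lowerSpan]
  congr 1
  ext x
  simp [eq_comm]

/-- Turns congruences modulo `A(< λ)` into the vanishing of coordinates, one block at a time; only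
in this form can two partial orders be compared. -/
theorem mem_lowerSpan_iff (hC : C.Bijective) (l : D.index) (x : A) :
    x ∈ lowerSpan 𝓑 D C l ↔ ∀ t : D.Triple, ¬ t.1 < l → 𝓑.repr x (C t) = 0 := by
  rw [lowerSpan_eq, 𝓑.mem_span_image]
  constructor
  · intro h t ht
    by_contra h'
    obtain ⟨t', ht', e⟩ := h (Finsupp.mem_support_iff.2 h')
    rw [hC.1 e] at ht'
    exact ht ht'
  · intro h i hi
    obtain ⟨t, rfl⟩ := hC.2 i
    by_contra h'
    exact Finsupp.mem_support_iff.1 hi (h t fun h'' => h' ⟨t, h'', rfl⟩)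

end ExtendC

/-! ### The leading coefficients of the structure constants -/

variable {𝓑 : Module.Basis ι LaurentRing A} {D : TableTuple.{u} A} {C : D.Triple → ι}

namespace IsTableDatum

/-- Take the coordinate at `C(S, b'', V)` in (A3). The block `λ` is not below itself, so the
congruence is an equality there, and only the summand `S' = S` contributes. The point is that `r` is
independent of `V`, `b'`, `b''`. -/
theorem exists_structConst_eq (h : IsTableDatum 𝓑 D C) (l : D.index) (S T : D.M l)
    (b : (D.table l).B) : ∃ r : (D.table l).B →₀ LaurentRing, ∀ (V : D.M l) (b' b'' : (D.table l).B),
      structConst 𝓑 (C ⟨l, S, b, T⟩) (C ⟨l, T, b', V⟩) (C ⟨l, S, b'', V⟩) =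
        r.sum fun c p => (D.table l).kappa b'' ((c : (D.table l).carrier) * b') • p := by
  classical
  obtain ⟨r, hr⟩ := h.mul_mod_lower l (𝓑 (C ⟨l, S, b, T⟩))
  refine ⟨(D.table l).laurentBasis.repr (r S T), fun V b' b'' => ?_⟩
  have h1 := (mem_lowerSpan_iff 𝓑 D h.bijective l _).1 (hr T V b') ⟨l, S, b'', V⟩ (lt_irrefl l)
  rw [extendC_one_tmul, map_sub, map_sum, Finsupp.sub_apply, sub_eq_zero, Finsupp.finsetSum_apply,
    Finset.sum_eq_single S, repr_extendC_self 𝓑 D h.bijective.1,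
    NormalizedTableAlgebra.laurentBasis_repr_mul] at h1
  · exact h1
  · intro S' _ hS'
    refine repr_extendC_of_ne 𝓑 D h.bijective.1 l S' V _ _ fun c hc => hS' ?_
    cases hc
    rfl
  · simp

theorem star_apply' (h : IsTableDatum 𝓑 D C) (t : D.Triple) :
    D.star (𝓑 (C t)) = 𝓑 (C (D.starTriple t)) := h.star_apply _ _ _ _

theorem repr_star (h : IsTableDatum 𝓑 D C) (x : A) (t : D.Triple) :
    𝓑.repr (D.star x) (C (D.starTriple t)) = 𝓑.repr x (C t) := by
  suffices e : 𝓑.coord (C (D.starTriple t)) ∘ₗ D.star = 𝓑.coord (C t) from LinearMap.congr_fun e x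
  refine 𝓑.ext fun i => ?_
  obtain ⟨s, rfl⟩ := h.bijective.2 i
  classical
  rw [LinearMap.comp_apply, h.star_apply', Module.Basis.coord_apply, Module.Basis.coord_apply,
    𝓑.repr_self, 𝓑.repr_self, Finsupp.single_apply, Finsupp.single_apply]
  refine if_congr ⟨fun e => ?_, fun e => ?_⟩ rfl rfl
  · rw [← starTriple_starTriple s, h.bijective.1 e, starTriple_starTriple]
  · rw [h.bijective.1 e]

theorem structConst_star (h : IsTableDatum 𝓑 D C) (x y t : D.Triple) :
    structConst 𝓑 (C (D.starTriple y)) (C (D.starTriple x)) (C (D.starTriple t)) =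
      structConst 𝓑 (C x) (C y) (C t) := by
  rw [structConst, structConst, ← h.star_apply', ← h.star_apply', ← h.star_mul, h.repr_star]

theorem aFun_star (h : IsTableDatum 𝓑 D C) (t : D.Triple) :
    aFun 𝓑 (C (D.starTriple t)) = aFun 𝓑 (C t) := by
  have key : ∀ t : D.Triple, degreeSet 𝓑 (C t) ⊆ degreeSet 𝓑 (C (D.starTriple t)) := by
    rintro t d ⟨X, Y, hd⟩
    obtain ⟨x, rfl⟩ := h.bijective.2 X
    obtain ⟨y, rfl⟩ := h.bijective.2 Y
    exact ⟨_, _, by rw [h.structConst_star, hd]⟩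
  rw [aFun, aFun]
  congr 1
  refine (key t).antisymm' ?_
  have h' := key (D.starTriple t)
  rwa [starTriple_starTriple] at h'

theorem gammaCoeff_star (h : IsTableDatum 𝓑 D C) (x y t : D.Triple) :
    gammaCoeff 𝓑 (C (D.starTriple y)) (C (D.starTriple x)) (C (D.starTriple t)) =
      gammaCoeff 𝓑 (C x) (C y) (C t) := by
  rw [gammaCoeff, gammaCoeff, h.structConst_star, h.aFun_star]

end IsTableDatum

variable {τ : A →ₗ[LaurentRing] LaurentRing}

namespace IsTraceDatum

theorem degree_le (h : IsTraceDatum 𝓑 τ D C) (X Y Z : ι) :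
    (structConst 𝓑 X Y Z).degree ≤ (aFun 𝓑 Z : WithBot ℤ) := by
  rcases hd : (structConst 𝓑 X Y Z).degree with _ | d
  · exact bot_le
  · exact WithBot.coe_le_coe.2 ((h.a_isGreatest Z).2 ⟨X, Y, hd⟩)

theorem degree_eq_iff (h : IsTraceDatum 𝓑 τ D C) (k k' k'' : D.Triple) :
    (structConst 𝓑 (C k) (C k') (C k'')).degree = (aFun 𝓑 (C k'') : WithBot ℤ) ↔
      D.mulCoeff k k' k'' ≠ 0 := by
  rw [h.bound_iff, mulCoeff_ne_zero_iff]

theorem gammaCoeff_eq_zero (h : IsTraceDatum 𝓑 τ D C) {k k' k'' : D.Triple}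
    (hk : D.mulCoeff k k' k'' = 0) : gammaCoeff 𝓑 (C k) (C k') (C k'') = 0 :=
  coeff_eq_zero_of_degree_lt <| lt_of_le_of_ne (h.degree_le _ _ _) fun e =>
    (h.degree_eq_iff k k' k'').1 e hk

/-- The leading coefficients of the structure constants are those of the matrix rings over the
table algebras, up to a factor that depends on the left factor only. -/
theorem exists_gammaCoeff_eq (h : IsTableDatum 𝓑 D C) (h' : IsTraceDatum 𝓑 τ D C) (l : D.index)
    (S T : D.M l) (b : (D.table l).B) :
    ∃ p : LaurentRing, ∃ d : ℤ, ∀ (V : D.M l) (b' b'' : (D.table l).B),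
      gammaCoeff 𝓑 (C ⟨l, S, b, T⟩) (C ⟨l, T, b', V⟩) (C ⟨l, S, b'', V⟩) =
        (D.table l).kappa b'' ((b : (D.table l).carrier) * b') * p.coeff d := by
  classical
  -- The `a`-function is constant on the triples of the block with given first index `S`.
  have hdeg : ∀ (b : (D.table l).B) (V : D.M l),
      aFun 𝓑 (C ⟨l, S, b, V⟩) = aFun 𝓑 (C ⟨l, S, (D.table l).oneB, S⟩) := by
    intro b V
    have key : ∀ (V V' : D.M l), aFun 𝓑 (C ⟨l, S, b, V⟩) =
        aFun 𝓑 (C ⟨l, S, (D.table l).oneB, V'⟩) := by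
      intro V V'
      obtain ⟨r, hr⟩ := h.exists_structConst_eq l S V b
      have h1 := hr V (D.table l).oneB b
      have h2 := hr V' ((D.table l).barB b) (D.table l).oneB
      have e1 : (structConst 𝓑 _ _ (C ⟨l, S, b, V⟩)).degree = _ :=
        (h'.degree_eq_iff ⟨l, S, b, V⟩ ⟨l, V, (D.table l).oneB, V⟩ ⟨l, S, b, V⟩).2 (by
          have := mulCoeff_unitTriple_right l S V b
          rw [unitTriple] at this
          rw [this]; simp)
      have e2 : (structConst 𝓑 _ _ (C ⟨l, S, (D.table l).oneB, V'⟩)).degree = _ :=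
        (h'.degree_eq_iff ⟨l, S, b, V⟩ ⟨l, V, (D.table l).barB b, V'⟩
          ⟨l, S, (D.table l).oneB, V'⟩).2 (by
          rw [mulCoeff_same, NormalizedTableAlgebra.kappa_oneB_mul_ne_zero])
      -- Both constants equal the coefficient `r b`, because `κ(1, c b̄) = κ(c, b)`; both attain
      -- their bounds, so the two `a`-values coincide.
      have e3 : structConst 𝓑 (C ⟨l, S, b, V⟩) (C ⟨l, V, (D.table l).oneB, V⟩)
          (C ⟨l, S, b, V⟩) = structConst 𝓑 (C ⟨l, S, b, V⟩)
            (C ⟨l, V, (D.table l).barB b, V'⟩) (C ⟨l, S, (D.table l).oneB, V'⟩) := by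
        rw [h1, h2]
        refine Finsupp.sum_congr fun c _ => ?_
        rw [NormalizedTableAlgebra.coe_oneB, mul_one]
        congr 1
        rw [NormalizedTableAlgebra.kappa_oneB_mul_barB]
        by_cases hcb : c = b
        · rw [hcb]
        · rw [NormalizedTableAlgebra.kappa_eq_of_ne _ hcb,
            NormalizedTableAlgebra.kappa_eq_of_ne _ (Ne.symm hcb)]
      rw [e3, e2] at e1
      exact (WithBot.coe_injective e1).symm
    exact key V S
  obtain ⟨r, hr⟩ := h.exists_structConst_eq l S T b
  refine ⟨r b, aFun 𝓑 (C ⟨l, S, (D.table l).oneB, S⟩), fun V b' b'' => ?_⟩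
  -- For `c ≠ b`, `r c` is the coefficient of `C(S, c, T)` in `C(S, b, T) C(T, 1, T)`, where the
  -- bound is not attained. So only the summand of `b` reaches the leading degree.
  have hlow : ∀ c, c ≠ b → (r c).coeff (aFun 𝓑 (C ⟨l, S, (D.table l).oneB, S⟩)) = 0 := by
    intro c hc
    have e1 : structConst 𝓑 (C ⟨l, S, b, T⟩) (C ⟨l, T, (D.table l).oneB, T⟩)
        (C ⟨l, S, c, T⟩) = r c := by
      rw [hr, Finsupp.sum, Finset.sum_eq_single c]
      · rw [NormalizedTableAlgebra.coe_oneB, mul_one, NormalizedTableAlgebra.kappa_self, one_smul]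
      · intro d _ hd
        rw [NormalizedTableAlgebra.coe_oneB, mul_one,
          NormalizedTableAlgebra.kappa_eq_of_ne _ hd.symm, zero_smul]
      · intro hc'
        rw [Finsupp.notMem_support_iff.1 hc', smul_zero]
    rw [← e1, ← hdeg c T]
    refine h'.gammaCoeff_eq_zero ?_
    rw [mulCoeff_same, NormalizedTableAlgebra.coe_oneB, mul_one,
      NormalizedTableAlgebra.kappa_eq_of_ne _ hc]
  rw [gammaCoeff, hr, hdeg, Finsupp.sum, AddMonoidAlgebra.coeff_sum, Finsupp.finsetSum_apply,
    Finset.sum_eq_single b]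
  · rw [coeff_zsmul]
  · intro c _ hc
    rw [coeff_zsmul, hlow c hc, mul_zero]
  · intro hb
    simp [Finsupp.notMem_support_iff.1 hb]

/-- The leading coefficients of the structure constants are the structure constants of the matrix
rings over the table algebras. -/
theorem gammaCoeff_eq (h : IsTableDatum 𝓑 D C) (h' : IsTraceDatum 𝓑 τ D C) (k k' k'' : D.Triple) :
    gammaCoeff 𝓑 (C k) (C k') (C k'') = D.mulCoeff k k' k'' := by
  by_cases hk : D.mulCoeff k k' k'' = 0
  · rw [hk, h'.gammaCoeff_eq_zero hk]
  obtain ⟨l, S, T, V, b, b', b'', rfl, rfl, rfl, -⟩ := mulCoeff_ne_zero_iff.1 hk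
  have key : ∃ q : ∀ (S T : D.M l) (b : (D.table l).B), ℤ, ∀ (S T V : D.M l)
      (b b' b'' : (D.table l).B),
      gammaCoeff 𝓑 (C ⟨l, S, b, T⟩) (C ⟨l, T, b', V⟩) (C ⟨l, S, b'', V⟩) =
        (D.table l).kappa b'' ((b : (D.table l).carrier) * b') * q S T b := by
    choose p d hpd using h'.exists_gammaCoeff_eq h l
    exact ⟨fun S T b => (p S T b).coeff (d S T b), fun S T V b b' b'' => hpd S T b V b' b''⟩
  obtain ⟨q, hq⟩ := key
  -- Apply `*` to the product of `C(S, b, T)` and `C(T, 1, T)`: the fixed element `C(T, 1, T)`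
  -- becomes the left factor.
  have hstar : q S T b = q T T (D.table l).oneB := by
    have e := h.gammaCoeff_star ⟨l, S, b, T⟩ ⟨l, T, (D.table l).oneB, T⟩ ⟨l, S, b, T⟩
    simp only [starTriple] at e
    rw [hq, hq, NormalizedTableAlgebra.barB_oneB, NormalizedTableAlgebra.coe_oneB, one_mul,
      mul_one, NormalizedTableAlgebra.kappa_self, NormalizedTableAlgebra.kappa_self, one_mul,
      one_mul] at e
    exact e.symm
  have hone := h'.gamma_one l T T T
  rw [hq, NormalizedTableAlgebra.coe_oneB, one_mul, ← NormalizedTableAlgebra.coe_oneB,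
    NormalizedTableAlgebra.kappa_self, one_mul] at hone
  rw [hq, hstar, hone, mul_one, mulCoeff_same]

end IsTraceDatum

end Asymptotic

/-! ### Bijections preserving the asymptotic structure constants -/

section TripleIso

variable {A : Type w} [NonUnitalRing A] [Module LaurentRing A]

open TableTuple

/-- A bijection between the triples of two tuples that preserves the structure constants of the
products of matrix rings. -/
structure TripleIso (D D' : TableTuple.{u} A) where
  toEquiv : D.Triple ≃ D'.Triple
  map_mulCoeff : ∀ x y z, D'.mulCoeff (toEquiv x) (toEquiv y) (toEquiv z) = D.mulCoeff x y z

namespace TripleIso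

variable {D D' : TableTuple.{u} A} (f : TripleIso D D')

/-- The inverse of a `TripleIso`. -/
def symm : TripleIso D' D where
  toEquiv := f.toEquiv.symm
  map_mulCoeff x y z := by rw [← f.map_mulCoeff]; simp

theorem fst_eq_iff (x y : D.Triple) : (f.toEquiv x).1 = (f.toEquiv y).1 ↔ x.1 = y.1 := by
  rw [TableTuple.fst_eq_iff, TableTuple.fst_eq_iff, f.toEquiv.surjective.exists]
  simp_rw [f.toEquiv.surjective.exists, f.map_mulCoeff]

theorem isUnitTriple_iff (t : D.Triple) : D'.IsUnitTriple (f.toEquiv t) ↔ D.IsUnitTriple t := by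
  rw [TableTuple.isUnitTriple_iff, TableTuple.isUnitTriple_iff, f.toEquiv.surjective.forall]
  simp_rw [f.toEquiv.surjective.forall, f.map_mulCoeff, f.toEquiv.apply_eq_iff_eq]

/-- Compatibility with the involutions is automatic, by the multiplicative description in
`starTriple_eq_iff`. -/
theorem map_starTriple (t : D.Triple) :
    f.toEquiv (D.starTriple t) = D'.starTriple (f.toEquiv t) := by
  rw [starTriple_eq_iff, f.toEquiv.surjective.exists]
  simp_rw [f.isUnitTriple_iff, f.map_mulCoeff]
  rw [← starTriple_eq_iff]

/-- The map on index sets, on representatives. -/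
noncomputable def indexFun (l : D.index) : D'.index :=
  (f.toEquiv (D.unitTriple l (Classical.arbitrary _))).1

theorem fst_apply (t : D.Triple) : (f.toEquiv t).1 = f.indexFun t.1 :=
  (f.fst_eq_iff _ _).2 rfl

/-- The bijection between the index sets induced by a `TripleIso`. -/
noncomputable def onIndex : D.index ≃ D'.index where
  toFun := f.indexFun
  invFun := f.symm.indexFun
  left_inv l := by
    refine (f.symm.fst_apply (f.toEquiv (D.unitTriple l (Classical.arbitrary _)))).symm.trans ?_
    rw [symm, f.toEquiv.symm_apply_apply, unitTriple]
  right_inv l := by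
    refine (f.fst_apply (f.toEquiv.symm (D'.unitTriple l (Classical.arbitrary _)))).symm.trans ?_
    rw [f.toEquiv.apply_symm_apply, unitTriple]

theorem fst_apply' (t : D.Triple) : (f.toEquiv t).1 = f.onIndex t.1 := f.fst_apply t

theorem exists_unitTriple (l : D.index) (S : D.M l) :
    ∃ S' : D'.M (f.onIndex l), f.toEquiv (D.unitTriple l S) = D'.unitTriple (f.onIndex l) S' := by
  have h := (f.isUnitTriple_iff _).2 (isUnitTriple_unitTriple l S)
  have h' : f.onIndex l = _ := (f.fst_apply' (D.unitTriple l S)).symm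
  generalize f.toEquiv (D.unitTriple l S) = t at h h' ⊢
  obtain ⟨l', S', b, T'⟩ := t
  obtain ⟨h1, h2⟩ := h
  change S' = T' at h1
  change b = (D'.table l').oneB at h2
  subst h1 h2
  change f.onIndex l = l' at h'
  subst h'
  exact ⟨S', rfl⟩

/-- The components of a `TripleIso` on a block. -/
structure BlockData (l : D.index) where
  onM : D.M l ≃ D'.M (f.onIndex l)
  onB : D.M l → D.M l → ((D.table l).B ≃ (D'.table (f.onIndex l)).B)
  apply_mk : ∀ S b T, f.toEquiv ⟨l, S, b, T⟩ = ⟨f.onIndex l, onM S, onB S T b, onM T⟩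

theorem exists_unitTriple_eq (l : D.index) (S' : D'.M (f.onIndex l)) :
    ∃ S : D.M l, f.toEquiv (D.unitTriple l S) = D'.unitTriple (f.onIndex l) S' := by
  obtain ⟨t, ht⟩ := f.toEquiv.surjective (D'.unitTriple (f.onIndex l) S')
  have h1 := (f.isUnitTriple_iff t).1 (by rw [ht]; exact isUnitTriple_unitTriple _ _)
  have h2 : f.onIndex t.1 = f.onIndex l := by rw [← f.fst_apply', ht]; rfl
  replace h2 := f.onIndex.injective h2
  obtain ⟨m, S, b, T⟩ := t
  obtain ⟨h3, h4⟩ := h1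
  change S = T at h3
  change b = (D.table m).oneB at h4
  change m = l at h2
  subst h2 h3 h4
  exact ⟨S, ht⟩

/-- The triple `(S, b, T)` occurs in its products with `(S, 1, S)` on the left and `(T, 1, T)` on
the right. The images of these two unit triples therefore fix the outer indices of its image. -/
theorem exists_apply_eq (l : D.index) (g : D.M l → D'.M (f.onIndex l))
    (hg : ∀ S, f.toEquiv (D.unitTriple l S) = D'.unitTriple (f.onIndex l) (g S)) (S T : D.M l)
    (b : (D.table l).B) :
    ∃ b', f.toEquiv ⟨l, S, b, T⟩ = ⟨f.onIndex l, g S, b', g T⟩ := by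
  have h1 := mulCoeff_unitTriple_left l S T b
  have h2 := mulCoeff_unitTriple_right l S T b
  rw [← f.map_mulCoeff, hg] at h1 h2
  obtain ⟨m, X, Y, Z, c, c', c'', e1, e2, e3, -⟩ :=
    mulCoeff_ne_zero_iff.1 (h1.trans_ne one_ne_zero)
  obtain ⟨m', X', Y', Z', d, d', d'', e1', e2', e3', -⟩ :=
    mulCoeff_ne_zero_iff.1 (h2.trans_ne one_ne_zero)
  rw [unitTriple] at e1 e2'
  cases e1
  rw [e2] at e1'
  cases e2'
  cases e1'
  exact ⟨c', e2⟩

/-- The unit triples of a block stand for the elements of `M(λ)`, so their images define `onM`; the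
middle entries are then permuted separately for each pair `(S, T)`. -/
theorem nonempty_blockData (l : D.index) : Nonempty (f.BlockData l) := by
  choose g hg using f.exists_unitTriple l
  choose φ hφ using f.exists_apply_eq l g hg
  have hinj : g.Injective := by
    intro S T h
    have e := f.toEquiv.injective ((hg S).trans ((congrArg _ h).trans (hg T).symm))
    rw [unitTriple, unitTriple] at e
    cases e
    rfl
  refine ⟨⟨Equiv.ofBijective g ⟨hinj, fun S' => ?_⟩, fun S T => Equiv.ofBijective (φ S T) ⟨?_, ?_⟩,
    fun S b T => hφ S T b⟩⟩
  · obtain ⟨S, hS⟩ := f.exists_unitTriple_eq l S'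
    rw [hg, unitTriple, unitTriple] at hS
    refine ⟨S, ?_⟩
    have h := eq_of_heq (Sigma.mk.inj hS).2
    exact congrArg Prod.fst h
  · intro b b' h
    have e := f.toEquiv.injective ((hφ S T b).trans ((by rw [h]) : _ = _) |>.trans (hφ S T b').symm)
    cases e
    rfl
  · intro b'
    obtain ⟨⟨m, X, c, Y⟩, ht⟩ := f.toEquiv.surjective ⟨f.onIndex l, g S, b', g T⟩
    have hm : m = l := f.onIndex.injective (by rw [← f.fst_apply' ⟨m, X, c, Y⟩, ht])
    subst hm
    rw [hφ] at ht
    have h := eq_of_heq (Sigma.mk.inj ht).2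
    have h1 := hinj (congrArg Prod.fst h)
    have h2 := hinj (congrArg (fun p => p.2.2) h)
    subst h1 h2
    exact ⟨c, congrArg (fun p => p.2.1) h⟩

/-- The components of a `TripleIso` on a block. -/
noncomputable def block (l : D.index) : f.BlockData l := Classical.choice (f.nonempty_blockData l)

namespace BlockData

variable {f} {l : D.index} (β : f.BlockData l)

/-- The linear extension of the bijections between the bases of the table algebras. -/
noncomputable def lin (S T : D.M l) :
    (D.table l).carrier ≃ₗ[ℤ] (D'.table (f.onIndex l)).carrier :=
  (D.table l).basis.equiv (D'.table (f.onIndex l)).basis (β.onB S T)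

theorem lin_coe (S T : D.M l) (b : (D.table l).B) : β.lin S T b = (β.onB S T b : _) := by
  rw [← (D.table l).basis_apply, lin, Module.Basis.equiv_apply,
    (D'.table (f.onIndex l)).basis_apply]

theorem kappa_lin (S T : D.M l) (b : (D.table l).B) (x : (D.table l).carrier) :
    (D'.table (f.onIndex l)).kappa (β.onB S T b) (β.lin S T x) = (D.table l).kappa b x := by
  suffices h : (D'.table (f.onIndex l)).basis.coord (β.onB S T b) ∘ₗ (β.lin S T).toLinearMap =
      (D.table l).basis.coord b from LinearMap.congr_fun h x
  refine (D.table l).basis.ext fun c => ?_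
  rw [LinearMap.comp_apply, LinearEquiv.coe_coe, (D.table l).basis_apply, lin_coe]
  change (D'.table (f.onIndex l)).kappa (β.onB S T b) (β.onB S T c : _) =
    (D.table l).kappa b (c : (D.table l).carrier)
  by_cases h : b = c
  · rw [h, NormalizedTableAlgebra.kappa_self, NormalizedTableAlgebra.kappa_self]
  · rw [NormalizedTableAlgebra.kappa_eq_of_ne _ h, NormalizedTableAlgebra.kappa_eq_of_ne _ fun e =>
      h ((β.onB S T).injective e)]

/-- Both sides have the same coefficients, by invariance of `mulCoeff`. Three different maps may
occur; for `S = T = V` this is ordinary multiplicativity. -/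
theorem onB_mul_onB (S T V : D.M l) (b c : (D.table l).B) :
    (β.onB S T b : (D'.table (f.onIndex l)).carrier) * β.onB T V c =
      β.lin S V ((b : (D.table l).carrier) * c) := by
  refine (D'.table (f.onIndex l)).basis.repr.injective (Finsupp.ext fun d' => ?_)
  obtain ⟨d, rfl⟩ := (β.onB S V).surjective d'
  change (D'.table (f.onIndex l)).kappa _ _ = (D'.table (f.onIndex l)).kappa _ _
  rw [kappa_lin, ← mulCoeff_same l S T V b c d, ← f.map_mulCoeff, β.apply_mk, β.apply_mk,
    β.apply_mk, mulCoeff_same]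

theorem lin_mul_lin (S T V : D.M l) (x y : (D.table l).carrier) :
    β.lin S T x * β.lin T V y = β.lin S V (x * y) := by
  suffices h : (LinearMap.mul ℤ _).compl₁₂ (β.lin S T).toLinearMap (β.lin T V).toLinearMap =
      (LinearMap.mul ℤ (D.table l).carrier).compr₂ (β.lin S V).toLinearMap from
    LinearMap.congr_fun (LinearMap.congr_fun h x) y
  refine (D.table l).basis.ext fun b => (D.table l).basis.ext fun c => ?_
  simp only [LinearMap.compl₁₂_apply, LinearMap.compr₂_apply, LinearMap.mul_apply',
    LinearEquiv.coe_coe, (D.table l).basis_apply, lin_coe, onB_mul_onB]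

end BlockData

end TripleIso

end TripleIso

section Transport

variable {A : Type w} [NonUnitalRing A] [Module LaurentRing A] {ι : Type z}

open TableTuple

/-! ### Left multiplication modulo a submodule -/

section ExtendC

variable (𝓑 : Module.Basis ι LaurentRing A) (D : TableTuple.{u} A) (C : D.Triple → ι)

theorem extendC_eq_constr (l : D.index) (S T : D.M l)
    (g : LaurentRing ⊗[ℤ] (D.table l).carrier) : extendC 𝓑 D C l S T g =
      (D.table l).laurentBasis.constr LaurentRing (fun b => 𝓑 (C ⟨l, S, b, T⟩)) g := by
  rw [Module.Basis.constr_apply, extendC]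

theorem extendC_add (l : D.index) (S T : D.M l) (g h : LaurentRing ⊗[ℤ] (D.table l).carrier) :
    extendC 𝓑 D C l S T (g + h) = extendC 𝓑 D C l S T g + extendC 𝓑 D C l S T h := by
  simp only [extendC_eq_constr, map_add]

/-- Left multiplication on the block of `λ` is, modulo the submodule `N`, given by matrices over
`ℤ[v, v⁻¹] ⊗ Γ(λ)`. -/
def MulModLower (l : D.index) (N : Submodule LaurentRing A) : Prop :=
  ∀ a : A, ∃ r : D.M l → D.M l → LaurentRing ⊗[ℤ] (D.table l).carrier,
    ∀ (S T : D.M l) (g : (D.table l).carrier),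
      a * extendC 𝓑 D C l S T (1 ⊗ₜ[ℤ] g) -
        ∑ S' : D.M l, extendC 𝓑 D C l S' T (r S' S * (1 ⊗ₜ[ℤ] g)) ∈ N

/-- The difference is additive in `g`, and `B(λ)` generates `Γ(λ)` additively. -/
theorem mul_extendC_sub_mem (l : D.index) (N : Submodule LaurentRing A) (a : A)
    (r : D.M l → LaurentRing ⊗[ℤ] (D.table l).carrier) (S T : D.M l)
    (h : ∀ b : (D.table l).B, a * 𝓑 (C ⟨l, S, b, T⟩) - ∑ S' : D.M l, extendC 𝓑 D C l S' T
      (r S' * (1 ⊗ₜ[ℤ] (b : (D.table l).carrier))) ∈ N) (g : (D.table l).carrier) :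
    a * extendC 𝓑 D C l S T (1 ⊗ₜ[ℤ] g) -
      ∑ S' : D.M l, extendC 𝓑 D C l S' T (r S' * (1 ⊗ₜ[ℤ] g)) ∈ N := by
  have hadd : ∀ x y, (a * extendC 𝓑 D C l S T (1 ⊗ₜ[ℤ] (x + y)) -
      ∑ S' : D.M l, extendC 𝓑 D C l S' T (r S' * (1 ⊗ₜ[ℤ] (x + y)))) =
      (a * extendC 𝓑 D C l S T (1 ⊗ₜ[ℤ] x) -
        ∑ S' : D.M l, extendC 𝓑 D C l S' T (r S' * (1 ⊗ₜ[ℤ] x))) +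
      (a * extendC 𝓑 D C l S T (1 ⊗ₜ[ℤ] y) -
        ∑ S' : D.M l, extendC 𝓑 D C l S' T (r S' * (1 ⊗ₜ[ℤ] y))) := by
    intro x y
    simp only [TensorProduct.tmul_add, mul_add, extendC_add, Finset.sum_add_distrib]
    abel
  let F : (D.table l).carrier →+ A := AddMonoidHom.mk' (fun g => a * extendC 𝓑 D C l S T (1 ⊗ₜ[ℤ] g) -
      ∑ S' : D.M l, extendC 𝓑 D C l S' T (r S' * (1 ⊗ₜ[ℤ] g))) hadd
  suffices h' : ∀ g, g ∈ N.toAddSubgroup.comap F from h' g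
  intro g
  have hg : g ∈ Submodule.span ℤ (Set.range (D.table l).basis) := (D.table l).basis.mem_span g
  rw [← AddSubgroup.toIntSubmodule_closure] at hg
  refine (AddSubgroup.closure_le _).2 ?_ hg
  rintro _ ⟨b, rfl⟩
  change _ ∈ N
  rw [(D.table l).basis_apply]
  have h' := h b
  rwa [← extendC_one_tmul] at h'

end ExtendC

variable {𝓑 : Module.Basis ι LaurentRing A} {D D' : TableTuple.{u} A}

/-! ### Transport of table data along isomorphisms of triples -/

namespace TripleIso.BlockData

variable {f : TripleIso D D'} {l : D.index} (β : f.BlockData l)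

/-- The extension of the bijections between the bases of the table algebras to
`ℤ[v, v⁻¹]`-linear maps. -/
noncomputable def laurentLin (S T : D.M l) : (LaurentRing ⊗[ℤ] (D.table l).carrier) ≃ₗ[LaurentRing]
    (LaurentRing ⊗[ℤ] (D'.table (f.onIndex l)).carrier) :=
  (D.table l).laurentBasis.equiv (D'.table (f.onIndex l)).laurentBasis (β.onB S T)

theorem laurentLin_laurentBasis (S T : D.M l) (b : (D.table l).B) :
    β.laurentLin S T ((D.table l).laurentBasis b) =
      (D'.table (f.onIndex l)).laurentBasis (β.onB S T b) := by
  rw [laurentLin, Module.Basis.equiv_apply]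

theorem laurentLin_repr (S T : D.M l) (x : LaurentRing ⊗[ℤ] (D.table l).carrier)
    (b : (D.table l).B) :
    (D'.table (f.onIndex l)).laurentBasis.repr (β.laurentLin S T x) (β.onB S T b) =
      (D.table l).laurentBasis.repr x b := by
  classical
  suffices h : (D'.table (f.onIndex l)).laurentBasis.coord (β.onB S T b) ∘ₗ
      (β.laurentLin S T).toLinearMap = (D.table l).laurentBasis.coord b from
    LinearMap.congr_fun h x
  refine (D.table l).laurentBasis.ext fun c => ?_
  rw [LinearMap.comp_apply, LinearEquiv.coe_coe, laurentLin_laurentBasis, Module.Basis.coord_apply,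
    Module.Basis.coord_apply, Module.Basis.repr_self, Module.Basis.repr_self, Finsupp.single_apply,
    Finsupp.single_apply]
  exact if_congr (β.onB S T).apply_eq_iff_eq rfl rfl

theorem laurentLin_one_tmul (S T : D.M l) (x : (D.table l).carrier) :
    β.laurentLin S T (1 ⊗ₜ[ℤ] x) = 1 ⊗ₜ[ℤ] (β.lin S T x) := by
  refine (D'.table (f.onIndex l)).laurentBasis.repr.injective (Finsupp.ext fun b' => ?_)
  obtain ⟨b, rfl⟩ := (β.onB S T).surjective b'
  rw [laurentLin_repr, NormalizedTableAlgebra.laurentBasis_repr_one_tmul,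
    NormalizedTableAlgebra.laurentBasis_repr_one_tmul, kappa_lin]

theorem laurentLin_mul (S T V : D.M l) (x : LaurentRing ⊗[ℤ] (D.table l).carrier)
    (b : (D.table l).B) : β.laurentLin S V (x * (1 ⊗ₜ[ℤ] (b : (D.table l).carrier))) =
      β.laurentLin S T x * (1 ⊗ₜ[ℤ] (β.onB T V b : (D'.table (f.onIndex l)).carrier)) := by
  suffices h : (β.laurentLin S V).toLinearMap ∘ₗ
      (LinearMap.mulRight LaurentRing (1 ⊗ₜ[ℤ] (b : (D.table l).carrier))) =
      (LinearMap.mulRight LaurentRing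
        (1 ⊗ₜ[ℤ] (β.onB T V b : (D'.table (f.onIndex l)).carrier))) ∘ₗ
        (β.laurentLin S T).toLinearMap from LinearMap.congr_fun h x
  refine (D.table l).laurentBasis.ext fun c => ?_
  simp only [LinearMap.comp_apply, LinearMap.mulRight_apply, LinearEquiv.coe_coe]
  rw [laurentLin_laurentBasis, NormalizedTableAlgebra.laurentBasis_apply,
    NormalizedTableAlgebra.laurentBasis_apply, Algebra.TensorProduct.tmul_mul_tmul,
    Algebra.TensorProduct.tmul_mul_tmul, one_mul, laurentLin_one_tmul, onB_mul_onB]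

variable {C : D.Triple → ι} {C' : D'.Triple → ι}

theorem extendC_laurentLin (hC : ∀ t, C' (f.toEquiv t) = C t) (S T : D.M l)
    (x : LaurentRing ⊗[ℤ] (D.table l).carrier) :
    extendC 𝓑 D' C' (f.onIndex l) (β.onM S) (β.onM T) (β.laurentLin S T x) =
      extendC 𝓑 D C l S T x := by
  rw [extendC_eq_constr, extendC_eq_constr]
  suffices h : ((D'.table (f.onIndex l)).laurentBasis.constr LaurentRing
      fun b => 𝓑 (C' ⟨f.onIndex l, β.onM S, b, β.onM T⟩)) ∘ₗ (β.laurentLin S T).toLinearMap =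
      (D.table l).laurentBasis.constr LaurentRing fun b => 𝓑 (C ⟨l, S, b, T⟩) from
    LinearMap.congr_fun h x
  refine (D.table l).laurentBasis.ext fun b => ?_
  rw [LinearMap.comp_apply, LinearEquiv.coe_coe, laurentLin_laurentBasis,
    Module.Basis.constr_basis, Module.Basis.constr_basis, ← β.apply_mk, hC]

end TripleIso.BlockData

variable {C : D.Triple → ι} {C' : D'.Triple → ι}

namespace TripleIso

variable (f : TripleIso D D')

theorem mulModLower (hC : ∀ t, C' (f.toEquiv t) = C t) {l : D.index}
    {N : Submodule LaurentRing A} (h : MulModLower 𝓑 D' C' (f.onIndex l) N) :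
    MulModLower 𝓑 D C l N := by
  intro a
  obtain ⟨r, hr⟩ := h a
  have β := f.block l
  -- The entry at `(S', S)` is pulled back by the map of that position; its product with `b` at `(S,
  -- T)` then corresponds to a product at `(S', T)`, by `laurentLin_mul`.
  refine ⟨fun S' S => (β.laurentLin S' S).symm (r (β.onM S') (β.onM S)), fun S T =>
    mul_extendC_sub_mem 𝓑 D C l N a _ S T fun b => ?_⟩
  have h1 := hr (β.onM S) (β.onM T) (β.onB S T b)
  rw [extendC_one_tmul, ← β.apply_mk, hC] at h1
  convert! h1 using 2
  refine Fintype.sum_equiv β.onM _ _ fun S' => ?_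
  rw [← β.extendC_laurentLin hC, β.laurentLin_mul S' S T, LinearEquiv.apply_symm_apply]

theorem lowerSpan_onIndex (hC : ∀ t, C' (f.toEquiv t) = C t)
    (ho : ∀ x y, f.onIndex x ≤ f.onIndex y ↔ x ≤ y) (l : D.index) :
    lowerSpan 𝓑 D' C' (f.onIndex l) = lowerSpan 𝓑 D C l := by
  rw [lowerSpan, lowerSpan]
  congr 1
  ext x
  simp only [Set.mem_ofPred_eq]
  rw [f.toEquiv.surjective.exists]
  simp_rw [f.fst_apply', hC, lt_iff_le_not_ge, ho]

end TripleIso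

/-- Table data are carried over along an isomorphism of triples that is compatible with the partial
orders. -/
theorem IsTableDatum.transport (h : IsTableDatum 𝓑 D C) (f : TripleIso D D')
    (hC : ∀ t, C' (f.toEquiv t) = C t) (ho : ∀ x y, f.onIndex x ≤ f.onIndex y ↔ x ≤ y)
    (hs : D'.star = D.star) : IsTableDatum 𝓑 D' C' where
  bijective := by
    rw [← Function.Bijective.of_comp_iff C' f.toEquiv.bijective]
    exact (funext hC : C' ∘ f.toEquiv = C) ▸ h.bijective
  idempotents := h.idempotents
  star_star := by rw [hs]; exact h.star_star
  star_mul := by rw [hs]; exact h.star_mul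
  star_apply l S T b := by
    change _ = 𝓑 (C' (D'.starTriple ⟨l, S, b, T⟩))
    obtain ⟨t, ht⟩ := f.toEquiv.surjective ⟨l, S, b, T⟩
    rw [← ht, hC, hs, h.star_apply', ← f.map_starTriple, hC]
  mul_mod_lower l := by
    obtain ⟨l, rfl⟩ := f.onIndex.surjective l
    have hC' : ∀ t, C (f.symm.toEquiv t) = C' t := fun t => by
      rw [← hC, TripleIso.symm, f.toEquiv.apply_symm_apply]
    refine f.symm.mulModLower hC' ?_
    have e : f.symm.onIndex (f.onIndex l) = l := f.onIndex.symm_apply_apply l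
    rw [f.lowerSpan_onIndex hC ho, e]
    exact h.mul_mod_lower l

/-- A smaller order on `Λ'` pulls back to a smaller order on `Λ`, for which the datum transported
back along the inverse satisfies the axioms. -/
theorem IsReducedDatum.transport (h : IsReducedDatum 𝓑 D C) (f : TripleIso D D')
    (hC : ∀ t, C' (f.toEquiv t) = C t) (ho : ∀ x y, f.onIndex x ≤ f.onIndex y ↔ x ≤ y)
    (hs : D'.star = D.star) : IsReducedDatum 𝓑 D' C' := by
  intro o hle ht
  let o' : PartialOrder D.index := @PartialOrder.lift _ _ o f.onIndex f.onIndex.injective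
  -- The inverse bijection serves for the changed orders as well, since `mulCoeff` does not involve
  -- them.
  let g : TripleIso (D'.withOrder o) (D.withOrder o') := ⟨f.symm.toEquiv, f.symm.map_mulCoeff⟩
  have hg : ∀ x, f.onIndex (g.onIndex x) = x := f.onIndex.apply_symm_apply
  have ht' : IsTableDatum 𝓑 (D.withOrder o') C := by
    refine ht.transport g (fun t => ?_) (fun x y => ?_) hs.symm
    · exact (hC _).symm.trans (congrArg C' (f.toEquiv.apply_symm_apply t))
    · change o.le (f.onIndex (g.onIndex x)) (f.onIndex (g.onIndex y)) ↔ o.le x y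
      rw [hg, hg]
  have he := h o' (fun x y hxy => (ho x y).1 (hle _ _ hxy)) ht'
  refine PartialOrder.ext fun x y => ⟨hle x y, fun hxy => ?_⟩
  obtain ⟨x, rfl⟩ := f.onIndex.surjective x
  obtain ⟨y, rfl⟩ := f.onIndex.surjective y
  have h1 : D.order.le x y := (ho x y).1 hxy
  rw [← he] at h1
  exact h1

variable {τ : A →ₗ[LaurentRing] LaurentRing}

theorem IsTraceDatum.transport (h : IsTableDatum 𝓑 D C) (h' : IsTraceDatum 𝓑 τ D C)
    (f : TripleIso D D') (hC : ∀ t, C' (f.toEquiv t) = C t) (hs : D'.star = D.star) :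
    IsTraceDatum 𝓑 τ D' C' where
  a_isGreatest := h'.a_isGreatest
  bound_iff := by
    simp_rw [← mulCoeff_ne_zero_iff]
    rw [f.toEquiv.surjective.forall]
    simp_rw [f.toEquiv.surjective.forall, hC, f.map_mulCoeff]
    exact h'.degree_eq_iff
  gamma_one l S T V := by
    -- For `S ≠ T` the preimage of `(S, 1, T)` need not have middle entry `1`, so the normalization
    -- for `D` does not suffice; all its leading coefficients are needed.
    have key : ∀ x y z, gammaCoeff 𝓑 (C' x) (C' y) (C' z) = D'.mulCoeff x y z := by
      rw [f.toEquiv.surjective.forall]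
      simp_rw [f.toEquiv.surjective.forall, hC, f.map_mulCoeff]
      exact h'.gammaCoeff_eq h
    rw [key, mulCoeff_same, NormalizedTableAlgebra.coe_oneB, one_mul,
      ← NormalizedTableAlgebra.coe_oneB, NormalizedTableAlgebra.kappa_self]
  trace_star := by rw [hs]; exact h'.trace_star
  trace_comm := h'.trace_comm
  trace_one l S := by
    obtain ⟨⟨m, X, b, Y⟩, ht⟩ := f.toEquiv.surjective (D'.unitTriple l S)
    have hu := (f.isUnitTriple_iff _).1 (ht ▸ isUnitTriple_unitTriple l S)
    obtain ⟨h1, h2⟩ := hu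
    change X = Y at h1
    change b = (D.table m).oneB at h2
    subst h1 h2
    rw [unitTriple] at ht
    rw [← ht, hC]
    exact h'.trace_one m X
  trace_zero l S T b hb := by
    obtain ⟨⟨m, X, c, Y⟩, ht⟩ := f.toEquiv.surjective ⟨l, S, b, T⟩
    have hu : ¬ D'.IsUnitTriple ⟨l, S, b, T⟩ := hb
    rw [← ht, f.isUnitTriple_iff] at hu
    rw [← ht, hC]
    exact h'.trace_zero m X Y c hu

theorem IsReducedTraceDatum.transport (h : IsReducedTraceDatum 𝓑 τ D C) (f : TripleIso D D')
    (hC : ∀ t, C' (f.toEquiv t) = C t) (ho : ∀ x y, f.onIndex x ≤ f.onIndex y ↔ x ≤ y)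
    (hs : D'.star = D.star) : IsReducedTraceDatum 𝓑 τ D' C' :=
  ⟨h.1.transport f hC ho hs, h.2.1.transport h.1 f hC hs, h.2.2.transport f hC ho hs⟩

/-! ### Comparison of two table data -/

/-- The bijection between the triples of two table data for the same algebra. -/
noncomputable def compareIso (h : IsTableDatum 𝓑 D C) (h' : IsTableDatum 𝓑 D' C')
    (t : IsTraceDatum 𝓑 τ D C) (t' : IsTraceDatum 𝓑 τ D' C') : TripleIso D D' where
  toEquiv := (Equiv.ofBijective C h.bijective).trans (Equiv.ofBijective C' h'.bijective).symm
  map_mulCoeff x y z := by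
    have e : ∀ x, C' ((Equiv.ofBijective C h.bijective).trans
        (Equiv.ofBijective C' h'.bijective).symm x) = C x := fun x =>
      (Equiv.ofBijective C' h'.bijective).apply_symm_apply (C x)
    rw [← t'.gammaCoeff_eq h', ← t.gammaCoeff_eq h, e, e, e]

theorem apply_compareIso (h : IsTableDatum 𝓑 D C) (h' : IsTableDatum 𝓑 D' C')
    (t : IsTraceDatum 𝓑 τ D C) (t' : IsTraceDatum 𝓑 τ D' C') (x : D.Triple) :
    C' ((compareIso h h' t t').toEquiv x) = C x :=
  (Equiv.ofBijective C' h'.bijective).apply_symm_apply (C x)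

/-- On basis elements `*` is `starTriple`, which every isomorphism of triples respects. -/
theorem IsTableDatum.star_eq (h : IsTableDatum 𝓑 D C) (h' : IsTableDatum 𝓑 D' C')
    (f : TripleIso D D') (hC : ∀ t, C' (f.toEquiv t) = C t) : D'.star = D.star := by
  refine 𝓑.ext fun i => ?_
  obtain ⟨t, rfl⟩ := h.bijective.2 i
  rw [h.star_apply', ← hC, h'.star_apply', ← f.map_starTriple, hC]

/-- The intersection of the order of `D` with the pullback of the order of `D'`. -/
@[reducible]
def TripleIso.infOrder (f : TripleIso D D') : PartialOrder D.index where
  le x y := x ≤ y ∧ f.onIndex x ≤ f.onIndex y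
  lt x y := (x ≤ y ∧ f.onIndex x ≤ f.onIndex y) ∧ ¬ (y ≤ x ∧ f.onIndex y ≤ f.onIndex x)
  lt_iff_le_not_ge _ _ := Iff.rfl
  le_refl _ := ⟨le_rfl, le_rfl⟩
  le_trans _ _ _ h h' := ⟨h.1.trans h'.1, h.2.trans h'.2⟩
  le_antisymm _ _ h h' := le_antisymm h.1 h'.1

/-- A block below `λ` for `D` but not for `D'` differs from `λ`, so the subtracted sums have no
coordinates in it. There the coordinate is that of `a C_{S,T}^g`, which vanishes by (A3) for `D'`.
Thus the coefficients `r` chosen for `D` work for the intersected order. -/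
theorem exists_repr_eq_zero (h : IsTableDatum 𝓑 D C) (h' : IsTableDatum 𝓑 D' C')
    (f : TripleIso D D') (hC : ∀ t, C' (f.toEquiv t) = C t) (l : D.index) (a : A) :
    ∃ r : D.M l → D.M l → LaurentRing ⊗[ℤ] (D.table l).carrier,
      ∀ (S T : D.M l) (g : (D.table l).carrier) (t : D.Triple), ¬ f.infOrder.lt t.1 l →
        𝓑.repr (a * extendC 𝓑 D C l S T (1 ⊗ₜ[ℤ] g) -
          ∑ S' : D.M l, extendC 𝓑 D C l S' T (r S' S * (1 ⊗ₜ[ℤ] g))) (C t) = 0 := by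
  obtain ⟨r, hr⟩ := h.mul_mod_lower l a
  obtain ⟨r', hr'⟩ := f.mulModLower (𝓑 := 𝓑) hC (h'.mul_mod_lower (f.onIndex l)) a
  refine ⟨r, fun S T g t ht => ?_⟩
  by_cases htl : t.1 < l
  · have h3 : ¬ f.onIndex t.1 < f.onIndex l := fun h4 =>
      ht ⟨⟨htl.le, h4.le⟩, fun h5 => htl.not_ge h5.1⟩
    have h2 := (mem_lowerSpan_iff 𝓑 D' h'.bijective (f.onIndex l) _).1 (hr' S T g) (f.toEquiv t)
      (by rwa [f.fst_apply'])
    have key : ∀ q : D.M l → D.M l → LaurentRing ⊗[ℤ] (D.table l).carrier,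
        𝓑.repr (∑ S' : D.M l, extendC 𝓑 D C l S' T (q S' S * (1 ⊗ₜ[ℤ] g))) (C t) = 0 := by
      intro q
      rw [map_sum, Finsupp.finsetSum_apply]
      refine Finset.sum_eq_zero fun S' _ => ?_
      refine repr_extendC_of_ne 𝓑 D h.bijective.1 l S' T _ t fun b hb => htl.ne ?_
      rw [hb]
    rw [hC, map_sub, Finsupp.sub_apply, key, sub_zero] at h2
    rw [map_sub, Finsupp.sub_apply, key, sub_zero, h2]
  · exact (mem_lowerSpan_iff 𝓑 D h.bijective l _).1 (hr S T g) t htl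

theorem isTableDatum_infOrder (h : IsTableDatum 𝓑 D C) (h' : IsTableDatum 𝓑 D' C')
    (f : TripleIso D D') (hC : ∀ t, C' (f.toEquiv t) = C t) :
    IsTableDatum 𝓑 (D.withOrder f.infOrder) C where
  bijective := h.bijective
  idempotents := h.idempotents
  star_star := h.star_star
  star_mul := h.star_mul
  star_apply := h.star_apply
  mul_mod_lower l a := by
    obtain ⟨r, hr⟩ := exists_repr_eq_zero h h' f hC l a
    exact ⟨r, fun S T g => (mem_lowerSpan_iff 𝓑 (D.withOrder f.infOrder) h.bijective l _).2
      (hr S T g)⟩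

/-- Reducedness forces the intersected order to be the whole order of `D`, so the latter lies in the
pullback of the order of `D'`. -/
theorem onIndex_le_of_le (h : IsTableDatum 𝓑 D C) (hr : IsReducedDatum 𝓑 D C)
    (h' : IsTableDatum 𝓑 D' C') (f : TripleIso D D') (hC : ∀ t, C' (f.toEquiv t) = C t)
    {x y : D.index} (hxy : x ≤ y) : f.onIndex x ≤ f.onIndex y := by
  have e := hr f.infOrder (fun x y hxy => hxy.1) (isTableDatum_infOrder h h' f hC)
  have h1 : D.order.le x y := hxy
  rw [← e] at h1
  exact h1.2

theorem onIndex_le_iff (h : IsTableDatum 𝓑 D C) (hr : IsReducedDatum 𝓑 D C)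
    (h' : IsTableDatum 𝓑 D' C') (hr' : IsReducedDatum 𝓑 D' C') (f : TripleIso D D')
    (hC : ∀ t, C' (f.toEquiv t) = C t) (x y : D.index) :
    f.onIndex x ≤ f.onIndex y ↔ x ≤ y := by
  refine ⟨fun hxy => ?_, onIndex_le_of_le h hr h' f hC⟩
  have hC' : ∀ t, C (f.symm.toEquiv t) = C' t := fun t => by
    rw [← hC, TripleIso.symm, f.toEquiv.apply_symm_apply]
  have h1 := onIndex_le_of_le h' hr' h f.symm hC' hxy
  have e : ∀ l, f.symm.onIndex (f.onIndex l) = l := f.onIndex.symm_apply_apply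
  rwa [e, e] at h1

end Transport

/-! ### Isomorphisms of matrix rings -/

theorem BasedRingIso.repr_apply {X Y : BasedRing.{u}} (f : BasedRingIso X Y) (x : X.carrier)
    (b : X.B) :
    Y.basis.repr (f.toRingEquiv x) ⟨f.toRingEquiv b, (f.map_mem_iff _).2 b.2⟩ =
      X.basis.repr x b := by
  classical
  suffices h : Y.basis.coord ⟨f.toRingEquiv b, (f.map_mem_iff _).2 b.2⟩ ∘ₗ
      f.toRingEquiv.toAddEquiv.toAddMonoidHom.toIntLinearMap = X.basis.coord b from
    LinearMap.congr_fun h x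
  refine X.basis.ext fun c => ?_
  have e : f.toRingEquiv.toAddEquiv.toAddMonoidHom.toIntLinearMap (X.basis c) =
      Y.basis ⟨f.toRingEquiv c, (f.map_mem_iff _).2 c.2⟩ := by
    rw [Y.basis_apply, X.basis_apply]
    rfl
  rw [LinearMap.comp_apply, e, Module.Basis.coord_apply, Module.Basis.coord_apply,
    Module.Basis.repr_self, Module.Basis.repr_self, Finsupp.single_apply, Finsupp.single_apply]
  refine if_congr ?_ rfl rfl
  rw [Subtype.mk.injEq, EmbeddingLike.apply_eq_iff_eq, Subtype.ext_iff]

theorem mem_matrixBasedRing_B {n : ℕ} {G : NormalizedTableAlgebra.{u}}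
    {x : Matrix (Fin n) (Fin n) G.carrier} :
    x ∈ (matrixBasedRing n G).B ↔ ∃ (i j : Fin n) (b : G.B), x = Matrix.single i j (b : G.carrier) := by
  constructor
  · rintro ⟨⟨i, j, b⟩, rfl⟩
    exact ⟨i, j, b, matrixTripleBasis_apply n G i j b⟩
  · rintro ⟨i, j, b, rfl⟩
    exact ⟨⟨i, j, b⟩, matrixTripleBasis_apply n G i j b⟩

section Functor

variable {A : Type w} [NonUnitalRing A] [Module LaurentRing A] {ι : Type z}

open TableTuple

namespace TripleIso.BlockData

variable {D D' : TableTuple.{u} A} {f : TripleIso D D'} {l : D.index} (β : f.BlockData l)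
  {n n' : ℕ} (s : D.M l ≃ Fin n) (s' : D'.M (f.onIndex l) ≃ Fin n')

/-- The isomorphism of matrix rings induced by a `TripleIso`. -/
noncomputable def matrixEquiv : Matrix (Fin n) (Fin n) (D.table l).carrier ≃+*
    Matrix (Fin n') (Fin n') (D'.table (f.onIndex l)).carrier where
  toFun x := Matrix.of fun i j => β.lin (β.onM.symm (s'.symm i)) (β.onM.symm (s'.symm j))
    (x (s (β.onM.symm (s'.symm i))) (s (β.onM.symm (s'.symm j))))
  invFun y := Matrix.of fun i j => (β.lin (s.symm i) (s.symm j)).symm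
    (y (s' (β.onM (s.symm i))) (s' (β.onM (s.symm j))))
  left_inv x := by
    ext i j
    simp only [Matrix.of_apply]
    rw [LinearEquiv.symm_apply_eq]
    simp
  right_inv y := by
    ext i j
    simp only [Matrix.of_apply]
    rw [← LinearEquiv.eq_symm_apply]
    simp
  map_add' x y := by
    ext i j
    simp
  -- Each entry is moved by the map of its own position; `lin_mul_lin` makes these maps fit together
  -- in the sum over the middle index.
  map_mul' x y := by
    ext i j
    simp only [Matrix.of_apply, Matrix.mul_apply, map_sum, lin_mul_lin]
    exact Fintype.sum_equiv ((s.symm.trans β.onM).trans s') _ _ fun k => by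
      simp

theorem matrixEquiv_single (S T : D.M l) (b : (D.table l).B) :
    β.matrixEquiv s s' (Matrix.single (s S) (s T) (b : (D.table l).carrier)) =
      Matrix.single (s' (β.onM S)) (s' (β.onM T)) (β.onB S T b : (D'.table (f.onIndex l)).carrier) := by
  ext i j
  obtain ⟨X', rfl⟩ := s'.surjective i
  obtain ⟨Y', rfl⟩ := s'.surjective j
  obtain ⟨X, rfl⟩ := β.onM.surjective X'
  obtain ⟨Y, rfl⟩ := β.onM.surjective Y'
  change β.lin (β.onM.symm (s'.symm (s' (β.onM X)))) (β.onM.symm (s'.symm (s' (β.onM Y))))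
    (Matrix.single _ _ _ (s (β.onM.symm (s'.symm (s' (β.onM X)))))
      (s (β.onM.symm (s'.symm (s' (β.onM Y)))))) = _
  rw [s'.symm_apply_apply, s'.symm_apply_apply, β.onM.symm_apply_apply, β.onM.symm_apply_apply]
  by_cases h : S = X ∧ T = Y
  · obtain ⟨rfl, rfl⟩ := h
    rw [Matrix.single_apply_same, Matrix.single_apply_same, β.lin_coe]
  · rw [Matrix.single_apply_of_ne _ _ _ _ _ (by simpa using h),
      Matrix.single_apply_of_ne _ _ _ _ _ (by simpa using h), map_zero]

/-- The isomorphism of based matrix rings induced by a `TripleIso`. -/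
noncomputable def matrixIso : BasedRingIso (matrixBasedRing n (D.table l))
    (matrixBasedRing n' (D'.table (f.onIndex l))) where
  toRingEquiv := β.matrixEquiv s s'
  map_mem_iff x := by
    constructor
    · intro h
      obtain ⟨i, j, c, h⟩ := mem_matrixBasedRing_B.1 h
      obtain ⟨X', rfl⟩ := s'.surjective i
      obtain ⟨Y', rfl⟩ := s'.surjective j
      obtain ⟨X, rfl⟩ := β.onM.surjective X'
      obtain ⟨Y, rfl⟩ := β.onM.surjective Y'
      obtain ⟨b, rfl⟩ := (β.onB X Y).surjective c
      rw [← matrixEquiv_single β s s'] at h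
      exact mem_matrixBasedRing_B.2 ⟨_, _, b, (β.matrixEquiv s s').injective h⟩
    · intro h
      obtain ⟨i, j, b, rfl⟩ := mem_matrixBasedRing_B.1 h
      obtain ⟨X, rfl⟩ := s.surjective i
      obtain ⟨Y, rfl⟩ := s.surjective j
      exact mem_matrixBasedRing_B.2 ⟨_, _, _, matrixEquiv_single β s s' X Y b⟩

end TripleIso.BlockData

variable {𝓑 : Module.Basis ι LaurentRing A} {τ : A →ₗ[LaurentRing] LaurentRing}

/-! ### Morphisms of table data -/

/-- Describes morphisms by a property that no longer mentions `C`; independence of the choice of `C`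
rests on this. -/
theorem exists_tripleIso {D D' : TableObj.{u} 𝓑 τ} {C : D.tuple.Triple → ι}
    (hC : IsReducedTraceDatum 𝓑 τ D.tuple C) {θ : D.tuple.Triple → D'.tuple.Triple}
    (hθ : IsMorphismFrom D D' C θ) : ∃ f : TripleIso D.tuple D'.tuple,
      ⇑f.toEquiv = θ ∧ ∀ x y, f.onIndex x ≤ f.onIndex y ↔ x ≤ y := by
  obtain ⟨C', hC', h⟩ := hθ
  refine ⟨compareIso hC.1 hC'.1 hC.2.1 hC'.2.1, ?_,
    onIndex_le_iff hC.1 hC.2.2 hC'.1 hC'.2.2 _ (apply_compareIso hC.1 hC'.1 hC.2.1 hC'.2.1)⟩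
  exact funext fun t => hC'.1.bijective.1 <|
    (apply_compareIso hC.1 hC'.1 hC.2.1 hC'.2.1 t).trans (h t).symm

theorem TableObj.star_eq (D D' : TableObj.{u} 𝓑 τ) : D'.tuple.star = D.tuple.star := by
  obtain ⟨C, hC⟩ := D.exists_datum
  obtain ⟨C', hC'⟩ := D'.exists_datum
  exact hC.1.star_eq hC'.1 _ (apply_compareIso hC.1 hC'.1 hC.2.1 hC'.2.1)

/-- The morphism of table data given by an isomorphism of triples that is compatible with the
partial orders. -/
def TripleIso.toHom {D D' : TableObj.{u} 𝓑 τ} (f : TripleIso D.tuple D'.tuple)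
    (ho : ∀ x y, f.onIndex x ≤ f.onIndex y ↔ x ≤ y) : D ⟶ D' :=
  { map := f.toEquiv
    isMorphism := fun C hC => by
      have e : ∀ t, (C ∘ f.toEquiv.symm) (f.toEquiv t) = C t := fun t => by
        rw [Function.comp_apply, f.toEquiv.symm_apply_apply]
      -- For any admissible `C` the partner is `C' = C ∘ f⁻¹`; the involutions of any two objects
      -- agree.
      exact ⟨C ∘ f.toEquiv.symm, hC.transport f e ho (D.star_eq D'), e⟩ : TableHom D D' }

theorem TableHom.exists_tripleIso {D D' : TableObj.{u} 𝓑 τ} (θ : D ⟶ D') :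
    ∃ f : TripleIso D.tuple D'.tuple,
      ⇑f.toEquiv = θ.map ∧ ∀ x y, f.onIndex x ≤ f.onIndex y ↔ x ≤ y := by
  obtain ⟨C, hC⟩ := D.exists_datum
  exact TabularAlg.exists_tripleIso hC (θ.isMorphism C hC)

/-! ### Based posets of table data -/

theorem Parametrization.toMap_injective {D : TableObj.{u} 𝓑 τ} (s : Parametrization D) :
    Function.Injective s.toMap := by
  rintro ⟨l, S, b, T⟩ ⟨l', S', b', T'⟩ h
  obtain rfl : l = l' := congrArg Sigma.fst h
  have h' : (Matrix.single (s l S) (s l T) (b : (D.tuple.table l).carrier) : Matrix _ _ _) =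
      Matrix.single (s l S') (s l T') (b' : (D.tuple.table l).carrier) :=
    eq_of_heq (Sigma.mk.inj h).2
  rw [← matrixTripleBasis_apply, ← matrixTripleBasis_apply] at h'
  have e := (matrixTripleBasis _ _).injective h'
  simp only [Prod.mk.injEq, EmbeddingLike.apply_eq_iff_eq] at e
  obtain ⟨rfl, rfl, rfl⟩ := e
  rfl

/-- The parametrization meets every block, as `M(λ)` is nonempty, and it runs through a `ℤ`-basis of
each matrix ring. -/
theorem basedPosetIso_ext {D D' : TableObj.{u} 𝓑 τ} (s : Parametrization D)
    {g g' : BasedPosetIso D.basedPoset D'.basedPoset}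
    (h : ∀ t, g.total (s.toMap t) = g'.total (s.toMap t)) : g = g' := by
  obtain ⟨e, r⟩ := g
  obtain ⟨e', r'⟩ := g'
  obtain rfl : e = e' := OrderIso.ext <| funext fun l : D.tuple.index =>
    congrArg Sigma.fst (h (D.tuple.unitTriple l (Classical.arbitrary (D.tuple.M l))))
  congr 1
  funext l
  refine BasedRingIso.ext (RingEquiv.ext fun x => ?_)
  suffices hx : (r l).toRingEquiv.toAddEquiv.toAddMonoidHom.toIntLinearMap =
      (r' l).toRingEquiv.toAddEquiv.toAddMonoidHom.toIntLinearMap from LinearMap.congr_fun hx x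
  refine (matrixTripleBasis _ _).ext ?_
  rintro ⟨i, j, b⟩
  obtain ⟨S, rfl⟩ := (s l).surjective i
  obtain ⟨T, rfl⟩ := (s l).surjective j
  rw [matrixTripleBasis_apply]
  exact eq_of_heq (Sigma.mk.inj (h ⟨l, S, b, T⟩)).2

theorem exists_basedPosetIso {D D' : TableObj.{u} 𝓑 τ} (s : Parametrization D)
    (s' : Parametrization D') (f : TripleIso D.tuple D'.tuple)
    (ho : ∀ x y, f.onIndex x ≤ f.onIndex y ↔ x ≤ y) :
    ∃ g : BasedPosetIso D.basedPoset D'.basedPoset,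
      ∀ t, g.total (s.toMap t) = s'.toMap (f.toEquiv t) := by
  refine ⟨⟨⟨f.onIndex, fun {x y} => ho x y⟩,
    fun l => (f.block l).matrixIso (s l) (s' (f.onIndex l))⟩, ?_⟩
  rintro ⟨l, S, b, T⟩
  rw [(f.block l).apply_mk]
  exact congrArg (Sigma.mk (f.onIndex l)) ((f.block l).matrixEquiv_single _ _ S T b)

/-- The triples of a block correspond to the basis of the matrix ring. -/
noncomputable def Parametrization.blockEquiv {D : TableObj.{u} 𝓑 τ} (s : Parametrization D)
    (l : D.tuple.index) : (D.tuple.M l × (D.tuple.table l).B × D.tuple.M l) ≃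
      (D.basedPoset.ring l).B :=
  ((Equiv.prodCongr (s l) ((Equiv.prodComm _ _).trans (Equiv.prodCongr (s l) (Equiv.refl _))))).trans
    (Equiv.ofInjective (matrixTripleBasis _ _) (matrixTripleBasis _ _).injective)

theorem Parametrization.coe_blockEquiv {D : TableObj.{u} 𝓑 τ} (s : Parametrization D)
    (l : D.tuple.index) (S T : D.tuple.M l) (b : (D.tuple.table l).B) :
    (s.blockEquiv l (S, b, T) : (D.basedPoset.ring l).carrier) =
      (Matrix.single (s l S) (s l T) (b : (D.tuple.table l).carrier) : Matrix _ _ _) :=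
  matrixTripleBasis_apply _ _ _ _ _

theorem Parametrization.toMap_mk {D : TableObj.{u} 𝓑 τ} (s : Parametrization D)
    (l : D.tuple.index) (x : D.tuple.M l × (D.tuple.table l).B × D.tuple.M l) :
    s.toMap ⟨l, x⟩ = ⟨l, s.blockEquiv l x⟩ := by
  obtain ⟨S, b, T⟩ := x
  rw [s.coe_blockEquiv]
  rfl

theorem Parametrization.mulCoeff_eq {D : TableObj.{u} 𝓑 τ} (s : Parametrization D)
    (l : D.tuple.index) (x y z : D.tuple.M l × (D.tuple.table l).B × D.tuple.M l) :
    D.tuple.mulCoeff ⟨l, x⟩ ⟨l, y⟩ ⟨l, z⟩ = (D.basedPoset.ring l).basis.repr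
      ((s.blockEquiv l x : (D.basedPoset.ring l).carrier) * s.blockEquiv l y)
        (s.blockEquiv l z) := by
  classical
  obtain ⟨S, b, T⟩ := x
  obtain ⟨U, b', V⟩ := y
  obtain ⟨X, b'', Y⟩ := z
  rw [mulCoeff_mk]
  refine Eq.trans ?_ (Module.Basis.reindexRange_repr (matrixTripleBasis _ (D.tuple.table l)) _
    (s l X, s l Y, b'')).symm
  rw [s.coe_blockEquiv, s.coe_blockEquiv]
  refine Eq.trans ?_ (matrixTripleBasis_repr _ (D.tuple.table l) _ (s l X) (s l Y) b'').symm
  change _ = (D.tuple.table l).kappa b'' _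
  congr 1
  by_cases h : T = U
  · subst h
    refine Eq.trans ?_ (congrFun (congrFun (Matrix.single_mul_single_same _ _ _ _ _) _) _).symm
    simp [Matrix.single_apply]
  · refine Eq.trans ?_ (congrFun (congrFun (Matrix.single_mul_single_of_ne _ _ _ _
      (fun e => h ((s l).injective e)) _) _) _).symm
    simp [h]

/-! ### From isomorphisms of based posets back to isomorphisms of triples -/

theorem TableTuple.mulCoeff_eq_zero {D : TableTuple.{u} A} {x y z : D.Triple}
    (h : ¬ (x.1 = y.1 ∧ x.1 = z.1)) : D.mulCoeff x y z = 0 := by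
  by_contra h'
  obtain ⟨l, S, T, V, b, b', b'', rfl, rfl, rfl, -⟩ := mulCoeff_ne_zero_iff.1 h'
  exact h ⟨rfl, rfl⟩

/-- The bijection between the triples of two blocks given by an isomorphism of based posets. -/
noncomputable def BasedPosetIso.blockEquiv {D D' : TableObj.{u} 𝓑 τ} (s : Parametrization D)
    (s' : Parametrization D') (g : BasedPosetIso D.basedPoset D'.basedPoset)
    (l : D.tuple.index) : (D.tuple.M l × (D.tuple.table l).B × D.tuple.M l) ≃
      (D'.tuple.M (g.onIndex l) × (D'.tuple.table (g.onIndex l)).B × D'.tuple.M (g.onIndex l)) :=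
  ((s.blockEquiv l).trans ((g.onRing l).toRingEquiv.toEquiv.subtypeEquiv fun x =>
    ((g.onRing l).map_mem_iff x).symm)).trans (s'.blockEquiv (g.onIndex l)).symm

theorem BasedPosetIso.blockEquiv_blockEquiv {D D' : TableObj.{u} 𝓑 τ} (s : Parametrization D)
    (s' : Parametrization D') (g : BasedPosetIso D.basedPoset D'.basedPoset)
    (l : D.tuple.index) (x : D.tuple.M l × (D.tuple.table l).B × D.tuple.M l) :
    s'.blockEquiv (g.onIndex l) (g.blockEquiv s s' l x) =
      ⟨(g.onRing l).toRingEquiv (s.blockEquiv l x),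
        ((g.onRing l).map_mem_iff _).2 (s.blockEquiv l x).2⟩ :=
  (s'.blockEquiv (g.onIndex l)).apply_symm_apply _

/-- The isomorphism of triples given by an isomorphism of based posets. -/
noncomputable def BasedPosetIso.tripleIso {D D' : TableObj.{u} 𝓑 τ} (s : Parametrization D)
    (s' : Parametrization D') (g : BasedPosetIso D.basedPoset D'.basedPoset) :
    TripleIso D.tuple D'.tuple where
  toEquiv := Equiv.sigmaCongr g.onIndex.toEquiv (g.blockEquiv s s')
  map_mulCoeff := by
    rintro ⟨l, x⟩ ⟨l', y⟩ ⟨l'', z⟩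
    by_cases h : l = l' ∧ l = l''
    · obtain ⟨rfl, rfl⟩ := h
      refine (s'.mulCoeff_eq (g.onIndex l) (g.blockEquiv s s' l x) (g.blockEquiv s s' l y)
        (g.blockEquiv s s' l z)).trans ?_
      rw [s.mulCoeff_eq, ← (g.onRing l).repr_apply, (g.onRing l).toRingEquiv.map_mul,
        g.blockEquiv_blockEquiv, g.blockEquiv_blockEquiv, g.blockEquiv_blockEquiv]
    · rw [mulCoeff_eq_zero (D := D.tuple) h, mulCoeff_eq_zero]
      rintro ⟨h1, h2⟩
      exact h ⟨g.onIndex.injective h1, g.onIndex.injective h2⟩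

theorem BasedPosetIso.total_toMap {D D' : TableObj.{u} 𝓑 τ} (s : Parametrization D)
    (s' : Parametrization D') (g : BasedPosetIso D.basedPoset D'.basedPoset) (t : D.tuple.Triple) :
    g.total (s.toMap t) = s'.toMap ((g.tripleIso s s').toEquiv t) := by
  obtain ⟨l, x⟩ := t
  refine Eq.trans ?_ (s'.toMap_mk (g.onIndex l) (g.blockEquiv s s' l x)).symm
  rw [s.toMap_mk]
  exact congrArg (fun y => (⟨g.onIndex l, y.1⟩ : Σ l : D'.basedPoset.index,
    (D'.basedPoset.ring l).carrier)) (g.blockEquiv_blockEquiv s s' l x).symm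

/-- The map on `Λ` recovered from the unit triples is `g.onIndex` by definition. -/
theorem BasedPosetIso.tripleIso_onIndex_le {D D' : TableObj.{u} 𝓑 τ} (s : Parametrization D)
    (s' : Parametrization D') (g : BasedPosetIso D.basedPoset D'.basedPoset)
    (x y : D.tuple.index) :
    (g.tripleIso s s').onIndex x ≤ (g.tripleIso s s').onIndex y ↔ x ≤ y :=
  g.onIndex.le_iff_le

end Functor

end TabularAlg

/-! ### The equivalence of categories -/

theorem theorem3p1p6 {A : Type w} [NonUnitalRing A] [Module TabularAlg.LaurentRing A]
    [IsScalarTower TabularAlg.LaurentRing A A] [SMulCommClass TabularAlg.LaurentRing A A]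
    {ι : Type z} (𝓑 : Module.Basis ι TabularAlg.LaurentRing A)
    (τ : A →ₗ[TabularAlg.LaurentRing] TabularAlg.LaurentRing)
    (_hA : Nonempty (TabularAlg.TableObj.{u} 𝓑 τ)) :
    -- the category of table data is well defined: the morphisms may be computed from any fixed `C`
    (∀ (D D' : TabularAlg.TableObj.{u} 𝓑 τ) (C : D.tuple.Triple → ι),
      TabularAlg.IsReducedTraceDatum 𝓑 τ D.tuple C →
        ∀ θ : D.tuple.Triple → D'.tuple.Triple,
          TabularAlg.IsMorphismFrom D D' C θ ↔ ∃ f : D ⟶ D', f.map = θ) ∧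
    -- for every choice of parametrizations, `P` is a functor and an equivalence of categories
    ∀ s : ∀ D : TabularAlg.TableObj.{u} 𝓑 τ, TabularAlg.Parametrization D,
      ∃ m : ∀ {D D' : TabularAlg.TableObj.{u} 𝓑 τ}, (D ⟶ D') →
          (D.toBasedPosetCat ⟶ D'.toBasedPosetCat),
        (∀ {D D' : TabularAlg.TableObj.{u} 𝓑 τ} (θ : D ⟶ D') (t : D.tuple.Triple),
          (m θ).hom.total ((s D).toMap t) = (s D').toMap (θ.map t)) ∧
        ∃ (hid : ∀ D : TabularAlg.TableObj.{u} 𝓑 τ, m (𝟙 D) = 𝟙 D.toBasedPosetCat)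
          (hcomp : ∀ {D D' D'' : TabularAlg.TableObj.{u} 𝓑 τ} (θ : D ⟶ D') (θ' : D' ⟶ D''),
            m (θ ≫ θ') = m θ ≫ m θ'),
          ({ obj := fun D => D.toBasedPosetCat, map := m, map_id := hid, map_comp := hcomp } :
            TabularAlg.TableObj.{u} 𝓑 τ ⥤
              TabularAlg.BasedPosetCat.{u} 𝓑 τ).IsEquivalence := by
  refine ⟨fun D D' C hC θ => ⟨fun hθ => ?_, ?_⟩, fun s => ?_⟩
  -- A map obtained from one `C` is an order-compatible isomorphism of triples, and hence a morphism
  -- with respect to every `C`.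
  · obtain ⟨f, rfl, ho⟩ := TabularAlg.exists_tripleIso hC hθ
    exact ⟨f.toHom ho, rfl⟩
  · rintro ⟨f, rfl⟩
    exact f.isMorphism C hC
  have hex : ∀ (D D' : TabularAlg.TableObj.{u} 𝓑 τ) (θ : D ⟶ D'),
      ∃ g : D.toBasedPosetCat ⟶ D'.toBasedPosetCat, ∀ t : D.tuple.Triple,
        g.hom.total ((s D).toMap t) = (s D').toMap (θ.map t) := by
    intro D D' θ
    obtain ⟨f, hf, ho⟩ := TabularAlg.TableHom.exists_tripleIso θ
    obtain ⟨g, hg⟩ := TabularAlg.exists_basedPosetIso (s D) (s D') f ho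
    rw [hf] at hg
    exact ⟨ObjectProperty.homMk g, hg⟩
  choose m hm using hex
  -- Uniqueness gives both functor laws, and identifies the image of the constructed preimage in the
  -- proof of fullness.
  have huniq : ∀ {D D' : TabularAlg.TableObj.{u} 𝓑 τ}
      {g g' : D.toBasedPosetCat ⟶ D'.toBasedPosetCat},
      (∀ t, g.hom.total ((s D).toMap t) = g'.hom.total ((s D).toMap t)) → g = g' := fun h =>
    ObjectProperty.hom_ext _ (TabularAlg.basedPosetIso_ext (s _) h)
  have hid : ∀ D : TabularAlg.TableObj.{u} 𝓑 τ, m D D (𝟙 D) = 𝟙 D.toBasedPosetCat :=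
    fun D => huniq fun t => hm D D (𝟙 D) t
  have hcomp : ∀ {D D' D'' : TabularAlg.TableObj.{u} 𝓑 τ} (θ : D ⟶ D') (θ' : D' ⟶ D''),
      m D D'' (θ ≫ θ') = m D D' θ ≫ m D' D'' θ' := fun {D D' D''} θ θ' => huniq fun t =>
    (hm D D'' (θ ≫ θ') t).trans ((congrArg (m D' D'' θ').hom.total (hm D D' θ t)).trans
      (hm D' D'' θ' (θ.map t))).symm
  refine ⟨fun {D D'} θ => m D D' θ, fun {D D'} θ t => hm D D' θ t, hid, hcomp, ?_⟩
  refine { faithful := ⟨fun {D D'} θ θ' h => ?_⟩, full := ⟨fun {D D'} g => ?_⟩, essSurj := ⟨?_⟩ }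
  · refine TabularAlg.TableHom.ext (funext fun t => (s D').toMap_injective ?_)
    rw [← hm D D' θ t, ← hm D D' θ' t]
    exact congrArg (fun g => g.hom.total ((s D).toMap t)) h
  · refine ⟨(TabularAlg.BasedPosetIso.tripleIso (s D) (s D') g.hom).toHom
      (TabularAlg.BasedPosetIso.tripleIso_onIndex_le (s D) (s D') g.hom), huniq fun t => ?_⟩
    exact (hm D D' _ t).trans
      (TabularAlg.BasedPosetIso.total_toMap (s D) (s D') g.hom t).symm
  · rintro ⟨_, D, rfl⟩
    exact ⟨D, ⟨Iso.refl _⟩⟩
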